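/- Fix $d\in\mathbb N\cup\{\infty\}$ and let $\mathbb F^d$ be the free monoid of words in $d$ letters. Let $\mathbb H^2_d$ be the full Fock space, i.e. the Hilbert space of formal power series $h=\sum_{\omega\in\mathbb F^d}\hat h_\omega \mathfrak z^\omega$ in $d$ non-commuting variables with $\sum_\omega|\hat h_\omega|^2<\infty$, and let $\mathbb H^\infty_d$ be its algebra of left multipliers, i.e. of the power series $f$ such that $h\mapsto f\cdot h$ maps $\mathbb H^2_d$ into itself (such a map is automatically bounded). Elements $f$ of $\mathbb H^\infty_d$ are viewed as non-commutative functions $Z\mapsto f(Z)=\sum_\omega\hat f_\omega Z^\omega$ on the open unit row-ball $\mathbb B^d_{\mathbb N}=\bigsqcup_n\mathbb B^d_n$, where $\mathbb B^d_n$ is the set of $d$-tuples $Z$ of complex $n\times n$ matrices with $\sum_j Z_jZ_j^*<I_n$. For $f\in\mathbb H^\infty_d$ let $f^{\mathrm t}=\sum_\omega\hat f_\omega\mathfrak z^{\omega^{\mathrm t}}$ be the series in which every word is reversed, and let $f(R)$ denote the bounded operator $h\mapsto h\cdot f^{\mathrm t}$ on $\mathbb H^2_d$; for a bounded operator or a matrix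 $T$ put $\operatorname{Re}T=\frac12(T+T^*)$. Call $f\in\mathbb H^\infty_d$ NC rational if there is an NC rational expression (a finite combination of the variables and complex scalars by $+$, $\cdot$, ${}^{-1}$), defined at $0$, whose values agree with those of $f$ at all points of $\mathbb B^d_{\mathbb N}$ where the expression is defined. Call $f$ Herglotz if $\operatorname{Re}f(Z)\ge0$ for all $Z\in\mathbb B^d_{\mathbb N}$. A Fornasini--Marchesini (FM) realization of $f$ of size $n\ge 0$ consists of $A_j\in\mathbb C^{n\times n}$, $B_j\in\mathbb C^{n}$ $(1\le j\le d)$, $C\in\mathbb C^{1\times n}$ and $D\in\mathbb C$ such that $$f(X)=D\,I_m+(C\otimes I_m)\Bigl(I_n\otimes I_m-\sum_j A_j\otimes X_j\Bigr)^{-1}\Bigl(\sum_j B_j\otimes X_j\Bigr)$$ for all $m$ and $X\in\mathbb B^d_m$ (the inverse existing, and the sums converging if $d=\infty$); $\dim_{FM}f$ is the smallest size of an FM realization of $f$. **Proposition.** Let $\mathfrak r\in\mathbb H^\infty_d$ be NC rational. Then $\dim_{FM}\mathfrak r<\infty$ and there is an NC rational Herglotz function $\mathfrak H\in\mathbb H^\infty_d$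 such that $$\mathfrak r(R)^*\,\mathfrak r(R)=\operatorname{Re}\mathfrak H(R)\ge0\qquad\text{and}\qquad \dim_{FM}\mathfrak H\le\dim_{FM}\mathfrak r+1 .$$ -/

import Mathlib

open scoped Kronecker ComplexOrder

namespace NCFock

/-! ### Fock space and its multipliers

The `d` letters are the elements of `ι`; words are lists of letters, and a formal power series in
non-commuting variables is its family of coefficients. -/

/-- Formal power series `∑ f ω z^ω` in non-commuting variables indexed by `ι`. -/
abbrev Series (ι : Type*) := List ι → ℂ

/-- The full Fock space (free Hardy space): square-summable power series. -/
noncomputable abbrev Fock (ι : Type*) := ↥(lp (fun _ : List ι => ℂ) 2)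

/-- Product of formal power series: the coefficient of `ω` is the sum over all ways to write
`ω = α β`. -/
def conv {ι : Type*} (f g : Series ι) : Series ι :=
  fun ω => ∑ k ∈ Finset.range (ω.length + 1), f (ω.take k) * g (ω.drop k)

/-- The transpose `f^t`: reverse every monomial. -/
def transpose {ι : Type*} (f : Series ι) : Series ι := fun ω => f ω.reverse

/-- The free Hardy algebra: power series that left multiply the Fock space into itself. -/
def Hinf (ι : Type*) : Set (Series ι) := {f | ∀ h : Fock ι, Memℓp (conv f h) 2}

/-- Power series that right multiply the Fock space into itself. -/
def HinfRight (ι : Type*) : Set (Series ι) := {g | ∀ h : Fock ι, Memℓp (conv h g) 2}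

theorem conv_add_left {ι : Type*} (f h g : Series ι) : conv (f + h) g = conv f g + conv h g := by
  funext ω
  simp [conv, add_mul, Finset.sum_add_distrib]

theorem conv_smul_left {ι : Type*} (c : ℂ) (f g : Series ι) : conv (c • f) g = c • conv f g := by
  funext ω
  simp [conv, Finset.mul_sum, mul_assoc]

theorem conv_transpose {ι : Type*} (f h : Series ι) :
    conv h (transpose f) = transpose (conv f (transpose h)) := by
  funext ω
  simp only [conv, transpose, List.length_reverse]
  rw [← Finset.sum_range_reflect]
  refine Finset.sum_congr rfl fun k hk => ?_
  have hk' : k ≤ ω.length := Nat.lt_succ_iff.mp (Finset.mem_range.mp hk)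
  rw [show ω.length + 1 - 1 - k = ω.length - k by omega, List.reverse_drop, List.drop_reverse,
    List.reverse_reverse, mul_comm, show ω.length - (ω.length - k) = k by omega]

theorem memlp_transpose {ι : Type*} {h : Series ι} (hh : Memℓp h 2) :
    Memℓp (transpose h) 2 := by
  have h2 : 0 < (2 : ENNReal).toReal := by norm_num
  rw [memℓp_gen_iff h2] at hh ⊢
  exact hh.comp_injective List.reverse_injective

theorem transpose_mem_HinfRight {ι : Type*} {f : Series ι} (hf : f ∈ Hinf ι) :
    transpose f ∈ HinfRight ι := by
  intro h
  rw [conv_transpose]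
  exact memlp_transpose (hf ⟨transpose h, memlp_transpose h.2⟩)

/-- Right multiplication `h ↦ h g` as a linear map of the Fock space. -/
def rightMulLin {ι : Type*} (g : Series ι) (hg : g ∈ HinfRight ι) : Fock ι →ₗ[ℂ] Fock ι where
  toFun h := ⟨conv h g, hg h⟩
  map_add' h k := by
    apply Subtype.ext
    exact conv_add_left h k g
  map_smul' c h := by
    apply Subtype.ext
    exact conv_smul_left c h g

theorem continuous_coeff {ι : Type*} (ω : List ι) : Continuous fun h : Fock ι => h ω :=
  (continuous_apply ω).comp lp.uniformContinuous_coe.continuous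

/-- Right multiplication by a right multiplier is bounded, by the closed graph theorem. -/
noncomputable def rightMul {ι : Type*} (g : Series ι) (hg : g ∈ HinfRight ι) :
    Fock ι →L[ℂ] Fock ι :=
  ContinuousLinearMap.ofSeqClosedGraph (g := rightMulLin g hg) (by
    intro u x y hu hy
    ext ω
    refine tendsto_nhds_unique (((continuous_coeff ω).tendsto y).comp hy) ?_
    have hc : Continuous fun h : Fock ι => conv h g ω :=
      continuous_finsetSum _ fun k _ => (continuous_coeff (ω.take k)).mul continuous_const
    exact (hc.tendsto x).comp hu)

/-- `f(R)`, the operator of right multiplication by `f^t`. -/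
noncomputable def atR {ι : Type*} (f : Series ι) (hf : f ∈ Hinf ι) : Fock ι →L[ℂ] Fock ι :=
  rightMul (transpose f) (transpose_mem_HinfRight hf)

theorem atR_apply {ι : Type*} (f : Series ι) (hf : f ∈ Hinf ι) (h : Fock ι) (ω : List ι) :
    atR f hf h ω = conv h (transpose f) ω := rfl

/-- The real part `(T + T^*) / 2` of a bounded operator. -/
noncomputable def reOp {ι : Type*} (T : Fock ι →L[ℂ] Fock ι) : Fock ι →L[ℂ] Fock ι :=
  (1 / 2 : ℂ) • (T + ContinuousLinearMap.adjoint T)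

/-! ### Power series as functions on the row-ball -/

/-- Tuples of `n × n` matrices, one for each letter. -/
abbrev Tuple (ι : Type*) (n : ℕ) := ι → Matrix (Fin n) (Fin n) ℂ

/-- The open unit row-ball at level `n`: the sum of the `Z_j Z_j^*` converges and is `< I`. -/
def rowBall (ι : Type*) (n : ℕ) : Set (Tuple ι n) :=
  {Z | ∃ S : Matrix (Fin n) (Fin n) ℂ,
    HasSum (fun j => Z j * (Z j).conjTranspose) S ∧ (1 - S).PosDef}

/-- `Z^ω`, the product of the `Z_j` along the word `ω`. -/
def wordProd {ι : Type*} {n : ℕ} (Z : Tuple ι n) (ω : List ι) : Matrix (Fin n) (Fin n) ℂ :=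
  (ω.map Z).prod

/-- The power series `f` converges at `Z`, with value `M`. -/
def HasValue {ι : Type*} {n : ℕ} (f : Series ι) (Z : Tuple ι n)
    (M : Matrix (Fin n) (Fin n) ℂ) : Prop :=
  HasSum (fun ω : List ι => f ω • wordProd Z ω) M

/-- (Left) free Herglotz functions: `f` converges in the row-ball and `Re f(Z) ≥ 0` there. -/
def IsHerglotz {ι : Type*} (f : Series ι) : Prop :=
  ∀ (n : ℕ), ∀ Z ∈ rowBall ι n, ∃ M : Matrix (Fin n) (Fin n) ℂ,
    HasValue f Z M ∧ ((1 / 2 : ℂ) • (M + M.conjTranspose)).PosSemidef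

/-! ### NC rational functions -/

/-- NC rational expressions. -/
inductive RatExpr (ι : Type*) where
  | scalar (c : ℂ) : RatExpr ι
  | var (j : ι) : RatExpr ι
  | add (p q : RatExpr ι) : RatExpr ι
  | mul (p q : RatExpr ι) : RatExpr ι
  | inv (p : RatExpr ι) : RatExpr ι

/-- Value of an NC rational expression at a tuple of matrices; meaningful on the domain. -/
noncomputable def RatExpr.eval {ι : Type*} {n : ℕ} (X : Tuple ι n) :
    RatExpr ι → Matrix (Fin n) (Fin n) ℂ
  | .scalar c => c • 1
  | .var j => X j
  | .add p q => p.eval X + q.eval X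
  | .mul p q => p.eval X * q.eval X
  | .inv p => (p.eval X)⁻¹

/-- `X` lies in the domain of the expression: every inverse that occurs exists. -/
def RatExpr.InDom {ι : Type*} {n : ℕ} (X : Tuple ι n) : RatExpr ι → Prop
  | .scalar _ => True
  | .var _ => True
  | .add p q => p.InDom X ∧ q.InDom X
  | .mul p q => p.InDom X ∧ q.InDom X
  | .inv p => p.InDom X ∧ IsUnit (p.eval X)

/-- The function on the row-ball defined by `f` is NC rational: it is given by an NC rational
expression that is regular at `0`, wherever that expression is defined in the row-ball. -/
def IsNCRational {ι : Type*} (f : Series ι) : Prop :=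
  ∃ e : RatExpr ι, e.InDom (0 : Tuple ι 1) ∧
    ∀ (n : ℕ), ∀ Z ∈ rowBall ι n, e.InDom Z → HasValue f Z (e.eval Z)

/-! ### Fornasini--Marchesini realizations -/

/-- The matrices `(A, B, C, D)` of a Fornasini--Marchesini realization of size `n`. -/
structure FMData (ι : Type*) (n : ℕ) where
  A : ι → Matrix (Fin n) (Fin n) ℂ
  B : ι → Matrix (Fin n) Unit ℂ
  C : Matrix Unit (Fin n) ℂ
  D : ℂ

/-- `f(X) = D I + (C ⊗ I) (I - ∑ A_j ⊗ X_j)⁻¹ (∑ B_j ⊗ X_j)` for all `X` in the row-ball.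
The sums are finite if there are finitely many letters. The `submatrix` identifies
`ℂ ⊗ ℂ^m` with `ℂ^m`. -/
def FMData.Realizes {ι : Type*} {n : ℕ} (F : FMData ι n) (f : Series ι) : Prop :=
  ∀ (m : ℕ), ∀ X ∈ rowBall ι m,
    ∃ (P : Matrix (Fin n × Fin m) (Fin n × Fin m) ℂ) (Q : Matrix (Fin n × Fin m) (Unit × Fin m) ℂ),
      HasSum (fun j => F.A j ⊗ₖ X j) P ∧ HasSum (fun j => F.B j ⊗ₖ X j) Q ∧ IsUnit (1 - P) ∧
      HasValue f X (F.D • 1 +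
        ((F.C ⊗ₖ (1 : Matrix (Fin m) (Fin m) ℂ)) * (1 - P)⁻¹ * Q).submatrix
          (fun i => ((), i)) (fun i => ((), i)))

/-- The minimal size of a Fornasini--Marchesini realization (`⊤` if there is none). -/
noncomputable def fmDim {ι : Type*} (f : Series ι) : ℕ∞ :=
  ⨅ (n : ℕ) (_ : ∃ F : FMData ι n, F.Realizes f), (n : ℕ∞)

end NCFock

namespace NCFock

/-! ### Formal power series -/

section Series

variable {ι : Type*}

/-! Write `S_ω r` for the translate `α ↦ r (α ω)`. Since `r(R) e_β = e_β · r^t` lives on words with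
prefix `β`, the matrix of `r(R)^* r(R)` in the monomial basis is of Toeplitz type: an entry vanishes
unless one index is a prefix of the other, and `⟨r(R) e_{βγ}, r(R) e_β⟩ = ⟨r, S_{γ^t} r⟩` does not
depend on `β`. Such an operator is the real part of `H(R)`, where `H` is its analytic half: `H ∅ =
⟨r, r⟩` and `H ω = 2⟨r, S_ω r⟩` otherwise (`herglotzSeries`, `adjoint_comp_atR_eq`).

The series `r` and `H` share one state space, the span of the `S_ω r` with `ω ≠ ∅`. The matrices
`A_j`, `B_j` are the same for both; only the output functional changes, from the coefficient at `∅`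
to `2⟨r, ·⟩` (`canonicalFM_realizes`). This space embeds in that of any realization of `r`
(`finrank_stateSpan_le`), so the proof yields even `dim H ≤ dim r`.

The state space is finite-dimensional because rational series are recognizable
(`IsNCRational.recognizable`): recognizability survives sums, products and inverses, and nilpotent
matrix points read off individual coefficients.

The analytic input is that a finite-dimensional translation-invariant subspace of the Fock space
decays geometrically (`exists_weighted_orbitSpan`). Hence `H` is a multiplier and the realizations
converge on the row-ball. Poisson kernels write `V^* H(Z) V` as a finite sum of values of the
quadratic form of `H(R)`, which makes `H` Herglotz (`isHerglotz_of_positive`). Gaussian elimination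
turns the realization of `H` into a rational expression. -/

/-- The right translate `α ↦ f (α ν)`. -/
def shift (ν : List ι) : Series ι →ₗ[ℂ] Series ι where
  toFun f := fun α => f (α ++ ν)
  map_add' _ _ := rfl
  map_smul' _ _ := rfl

@[simp] theorem shift_apply (ν : List ι) (f : Series ι) (α : List ι) :
    shift ν f α = f (α ++ ν) := rfl

theorem shift_shift (ν μ : List ι) (f : Series ι) :
    shift ν (shift μ f) = shift (ν ++ μ) f := by
  funext α
  simp

open Classical in
/-- The monomial with exponent `α`. -/
noncomputable def mono (α : List ι) : Series ι := fun β => if β = α then 1 else 0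

theorem conv_nil (f g : Series ι) : conv f g [] = f [] * g [] := by
  simp [conv]

theorem conv_concat (f g : Series ι) (α : List ι) (j : ι) :
    conv f g (α ++ [j]) = conv f (shift [j] g) α + g [] * f (α ++ [j]) := by
  simp only [conv, List.length_append, List.length_singleton]
  rw [Finset.sum_range_succ]
  congr 1
  · refine Finset.sum_congr rfl fun k hk => ?_
    have hk' : k ≤ α.length := Nat.lt_succ_iff.mp (Finset.mem_range.mp hk)
    rw [List.take_append_of_le_length hk', List.drop_append_of_le_length hk']
    rfl
  · rw [List.take_of_length_le (by simp), List.drop_of_length_le (by simp), mul_comm]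

/-- Leibniz rule: the last letter of a product comes from `g`, unless `g` contributes only its
constant term. All the closure properties of recognizable series rest on it. -/
theorem shift_conv (f g : Series ι) (j : ι) :
    shift [j] (conv f g) = conv f (shift [j] g) + g [] • shift [j] f := by
  funext α
  simp [conv_concat]

theorem conv_add_right (f g h : Series ι) : conv f (g + h) = conv f g + conv f h := by
  funext ω
  simp [conv, mul_add, Finset.sum_add_distrib]

theorem conv_smul_right (c : ℂ) (f g : Series ι) : conv f (c • g) = c • conv f g := by
  funext ω
  simp only [conv, Pi.smul_apply, smul_eq_mul, Finset.mul_sum]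
  exact Finset.sum_congr rfl fun k _ => by ring

/-- Left multiplication by a fixed power series. -/
def convLin (f : Series ι) : Series ι →ₗ[ℂ] Series ι where
  toFun g := conv f g
  map_add' := conv_add_right f
  map_smul' c g := conv_smul_right c f g

theorem mono_nil_conv (f : Series ι) : conv (mono []) f = f := by
  funext ω
  rw [conv, Finset.sum_eq_single 0]
  · simp [mono]
  · intro k hk hk0
    have : ω.take k ≠ [] := by
      intro h
      have := congrArg List.length h
      simp at this hk
      rcases this with h | h
      · exact hk0 h
      · subst h; simp at hk; exact hk0 hk
    simp [mono, this]
  · simp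

theorem conv_mono_nil (f : Series ι) : conv f (mono []) = f := by
  funext ω
  induction ω using List.reverseRecOn with
  | nil => simp [conv_nil, mono]
  | append_singleton α j _ =>
    have h0 : shift [j] (mono ([] : List ι)) = 0 := by
      funext β; simp [mono]
    rw [conv_concat, h0]
    simp [conv, mono]

/-! ### Upper triangular matrices attached to a word -/

/-- The block Toeplitz matrix whose `(a, b)` entry is the (scaled) coefficient of `f` at the
subword of `ω` between the positions `a` and `b`. -/
noncomputable def wordMat (ω : List ι) (f : Series ι) :
    Matrix (Fin (ω.length + 1)) (Fin (ω.length + 1)) ℂ :=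
  Matrix.of fun a b => if a ≤ b then
    (1 / 2 : ℂ) ^ ((b : ℕ) - a) * f ((ω.drop a).take ((b : ℕ) - a)) else 0

theorem wordMat_apply (ω : List ι) (f : Series ι) (a b : Fin (ω.length + 1)) :
    wordMat ω f a b = if a ≤ b then
      (1 / 2 : ℂ) ^ ((b : ℕ) - a) * f ((ω.drop a).take ((b : ℕ) - a)) else 0 := rfl

theorem wordMat_zero_last (ω : List ι) (f : Series ι) :
    wordMat ω f 0 (Fin.last _) = (1 / 2 : ℂ) ^ ω.length * f ω := by
  simp [wordMat_apply]

theorem wordMat_add (ω : List ι) (f g : Series ι) :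
    wordMat ω (f + g) = wordMat ω f + wordMat ω g := by
  ext a b
  simp only [wordMat_apply, Matrix.add_apply, Pi.add_apply]
  split_ifs <;> ring

theorem wordMat_smul (ω : List ι) (c : ℂ) (f : Series ι) :
    wordMat ω (c • f) = c • wordMat ω f := by
  ext a b
  simp only [wordMat_apply, Matrix.smul_apply, Pi.smul_apply, smul_eq_mul]
  split_ifs <;> ring

theorem wordMat_sum (ω : List ι) {κ : Type*} (s : Finset κ) (f : κ → Series ι) :
    wordMat ω (∑ i ∈ s, f i) = ∑ i ∈ s, wordMat ω (f i) := by
  classical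
  induction s using Finset.induction_on with
  | empty => ext a b; simp [wordMat_apply]
  | insert i s hi ih => rw [Finset.sum_insert hi, Finset.sum_insert hi, wordMat_add, ih]

theorem wordMat_one (ω : List ι) : wordMat ω (mono []) = 1 := by
  ext a b
  have ha := a.2
  have hb := b.2
  rw [wordMat_apply, Matrix.one_apply]
  by_cases hab : a = b
  · subst hab; simp [mono]
  · rw [if_neg hab]
    split_ifs with h
    · have hlt : (a : ℕ) < b := lt_of_le_of_ne h (fun h' => hab (Fin.ext h'))
      have : ((ω.drop a).take ((b : ℕ) - a)) ≠ [] := by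
        intro h'
        have := congrArg List.length h'
        simp at this
        omega
      simp [mono, this]
    · rfl

/-- The intermediate index `c` of the matrix product is the place where the subword between
positions `a` and `b` is cut, and the powers of `1/2` multiply because they count letters.
Identities between series thereby reduce to identities between matrices. -/
theorem wordMat_conv (ω : List ι) (f g : Series ι) :
    wordMat ω (conv f g) = wordMat ω f * wordMat ω g := by
  ext a b
  have hb := b.2
  rw [Matrix.mul_apply]
  by_cases hab : a ≤ b
  · have hab' : (a : ℕ) ≤ b := hab
    have hlen : ((ω.drop a).take ((b : ℕ) - a)).length = (b : ℕ) - a := by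
      simp; omega
    rw [wordMat_apply, if_pos hab, conv, hlen, Finset.mul_sum]
    symm
    rw [← Finset.sum_filter_of_ne (p := fun c : Fin (ω.length + 1) => a ≤ c ∧ c ≤ b)]
    · refine Finset.sum_nbij' (fun c => (c : ℕ) - a)
        (fun k => Fin.ofNat (ω.length + 1) (a + k)) ?_ ?_ ?_ ?_ ?_
      · intro c hc
        simp only [Finset.mem_filter, Finset.mem_univ, true_and, Finset.mem_range] at hc ⊢
        have h1 : (a : ℕ) ≤ c := hc.1
        have h2 : (c : ℕ) ≤ b := hc.2
        omega
      · intro k hk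
        simp only [Finset.mem_range] at hk
        have hm : (a + k) % (ω.length + 1) = a + k := Nat.mod_eq_of_lt (by omega)
        simp only [Finset.mem_filter, Finset.mem_univ, true_and, Fin.le_def, Fin.val_ofNat, hm]
        omega
      · intro c hc
        simp only [Finset.mem_filter, Finset.mem_univ, true_and] at hc
        have h1 : (a : ℕ) ≤ c := hc.1
        have h2 := c.2
        ext
        rw [Fin.val_ofNat, show (a : ℕ) + (c - a) = c by omega, Nat.mod_eq_of_lt h2]
      · intro k hk
        simp only [Finset.mem_range] at hk
        have hm : (a + k) % (ω.length + 1) = a + k := Nat.mod_eq_of_lt (by omega)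
        rw [Fin.val_ofNat, hm]
        omega
      · intro c hc
        simp only [Finset.mem_filter, Finset.mem_univ, true_and] at hc
        have h1 : (a : ℕ) ≤ c := hc.1
        have h2 : (c : ℕ) ≤ b := hc.2
        rw [wordMat_apply, wordMat_apply, if_pos hc.1, if_pos hc.2, List.take_take,
          List.drop_take, List.drop_drop, min_eq_left (by omega),
          show (a : ℕ) + (c - a) = c by omega, show (b : ℕ) - a - (c - a) = b - c by omega,
          show (b : ℕ) - a = (c - a) + (b - c) by omega, pow_add]
        ring
    · intro c _ hne
      by_contra hcon
      apply hne
      rw [wordMat_apply, wordMat_apply]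
      by_cases h1 : a ≤ c
      · have h2 : ¬ c ≤ b := fun h => hcon ⟨h1, h⟩
        simp [h2]
      · simp [h1]
  · rw [wordMat_apply, if_neg hab]
    symm
    refine Finset.sum_eq_zero fun c _ => ?_
    rw [wordMat_apply, wordMat_apply]
    by_cases h1 : a ≤ c
    · have h2 : ¬ c ≤ b := fun h => hab (h1.trans h)
      simp [h2]
    · simp [h1]

theorem ext_wordMat {f g : Series ι} (h : ∀ ω, wordMat ω f = wordMat ω g) : f = g := by
  funext ω
  have := congrFun (congrFun (h ω) 0) (Fin.last _)
  rw [wordMat_zero_last, wordMat_zero_last] at this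
  exact mul_left_cancel₀ (by positivity) this

theorem conv_assoc (f g h : Series ι) : conv (conv f g) h = conv f (conv g h) :=
  ext_wordMat fun ω => by simp only [wordMat_conv, mul_assoc]

theorem mono_conv_mono (α β : List ι) : conv (mono α) (mono β) = mono (α ++ β) := by
  funext ω
  rw [conv]
  by_cases h : ω = α ++ β
  · subst h
    rw [Finset.sum_eq_single α.length]
    · simp [mono]
    · intro k hk hne
      simp at hk
      have : (α ++ β).take k ≠ α := fun h' => hne (by
        have := congrArg List.length h'
        simp at this; omega)
      simp [mono, this]
    · intro h'; simp at h'
  · simp only [mono, h, if_false]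
    refine Finset.sum_eq_zero fun k _ => ?_
    split_ifs with h1 h2 <;> simp
    exact h (by rw [← h1, ← h2, List.take_append_drop])

/-! ### Inverses -/

/-- The coefficients of the right inverse of `f`, computed on words of length less than `n`. -/
noncomputable def invCoeff (f : Series ι) : ℕ → Series ι
  | 0 => 0
  | n + 1 => fun ω => (f [])⁻¹ * ((mono [] : Series ι) ω -
      ∑ k ∈ Finset.range ω.length, f (ω.take (k + 1)) * invCoeff f n (ω.drop (k + 1)))

theorem invCoeff_stable (f : Series ι) (n : ℕ) :
    ∀ m ω, ω.length < n → n ≤ m → invCoeff f m ω = invCoeff f n ω := by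
  induction n with
  | zero => intro m ω h; simp at h
  | succ n ih =>
    intro m ω h hm
    obtain ⟨m, rfl⟩ : ∃ m', m = m' + 1 := ⟨m - 1, by omega⟩
    simp only [invCoeff]
    congr 2
    refine Finset.sum_congr rfl fun k hk => ?_
    simp only [Finset.mem_range] at hk
    rw [ih m _ (by simp; omega) (by omega)]

/-- The equation at `ω` determines `g ω` from values of `g` at shorter words, because `f []` is
invertible. -/
theorem exists_right_inverse (f : Series ι) (hf : f [] ≠ 0) : ∃ g, conv f g = mono [] := by
  refine ⟨fun ω => invCoeff f (ω.length + 1) ω, ?_⟩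
  funext ω
  rw [conv, Finset.sum_range_succ']
  simp only [List.take_zero, List.drop_zero]
  have : invCoeff f (ω.length + 1) ω = (f [])⁻¹ * ((mono [] : Series ι) ω -
      ∑ k ∈ Finset.range ω.length, f (ω.take (k + 1)) *
        invCoeff f ((ω.drop (k + 1)).length + 1) (ω.drop (k + 1))) := by
    refine congrArg (fun x => (f [])⁻¹ * ((mono [] : Series ι) ω - x))
      (Finset.sum_congr rfl fun k hk => ?_)
    simp only [Finset.mem_range] at hk
    rw [invCoeff_stable f _ ω.length (ω.drop (k + 1)) (Nat.lt_succ_self _) (by simp; omega)]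
  rw [this]
  field_simp
  ring

/-! ### Recognizable series -/

/-- A power series is recognizable when it lies in a finite-dimensional space of series that is
invariant under right translations, all but finitely many letters acting as zero. -/
def Recognizable (f : Series ι) : Prop :=
  ∃ (W : Submodule ℂ (Series ι)) (J : Finset ι), FiniteDimensional ℂ W ∧ f ∈ W ∧
    (∀ j, ∀ w ∈ W, shift [j] w ∈ W) ∧ ∀ j ∉ J, ∀ w ∈ W, shift [j] w = 0

theorem shift_mono_nil (j : ι) : shift [j] (mono ([] : List ι)) = 0 := by
  funext α; simp [mono]

theorem recognizable_scalar (c : ℂ) : Recognizable (c • (mono [] : Series ι)) := by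
  refine ⟨Submodule.span ℂ {mono []}, ∅, inferInstance,
    Submodule.smul_mem _ _ (Submodule.subset_span rfl), ?_, ?_⟩
  · intro j w hw
    obtain ⟨a, rfl⟩ := Submodule.mem_span_singleton.mp hw
    simp [shift_mono_nil]
  · intro j _ w hw
    obtain ⟨a, rfl⟩ := Submodule.mem_span_singleton.mp hw
    simp [shift_mono_nil]

open Classical in
theorem shift_mono_letter (i j : ι) :
    shift [j] (mono [i]) = (if j = i then (1 : ℂ) else 0) • (mono [] : Series ι) := by
  funext α
  simp only [shift_apply, mono, Pi.smul_apply, smul_eq_mul]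
  rcases List.eq_nil_or_concat α with rfl | ⟨β, k, rfl⟩
  · simp
  · have : β.concat k ++ [j] ≠ [i] := fun h => by
      have := congrArg List.length h
      simp at this
    rw [if_neg this]
    simp

theorem recognizable_var (i : ι) : Recognizable (mono [i]) := by
  classical
  refine ⟨Submodule.span ℂ {mono [i], mono []}, {i},
    FiniteDimensional.span_of_finite ℂ (by simp), Submodule.subset_span (by simp), ?_, ?_⟩
  · intro j w hw
    obtain ⟨a, b, rfl⟩ := Submodule.mem_span_pair.mp hw
    simp only [map_add, map_smul, shift_mono_nil, shift_mono_letter]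
    simp only [smul_zero, add_zero]
    exact Submodule.smul_mem _ _ (Submodule.smul_mem _ _ (Submodule.subset_span (by simp)))
  · intro j hj w hw
    obtain ⟨a, b, rfl⟩ := Submodule.mem_span_pair.mp hw
    have : j ≠ i := by simpa using hj
    simp [shift_mono_nil, shift_mono_letter, this]

theorem Recognizable.add {f g : Series ι} (hf : Recognizable f) (hg : Recognizable g) :
    Recognizable (f + g) := by
  classical
  obtain ⟨W, J, hW, hfW, hinv, hz⟩ := hf
  obtain ⟨W', J', hW', hgW, hinv', hz'⟩ := hg
  refine ⟨W ⊔ W', J ∪ J', inferInstance, Submodule.add_mem_sup hfW hgW, ?_, ?_⟩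
  · intro j w hw
    obtain ⟨u, hu, v, hv, rfl⟩ := Submodule.mem_sup.mp hw
    rw [map_add]
    exact Submodule.add_mem_sup (hinv j u hu) (hinv' j v hv)
  · intro j hj w hw
    simp only [Finset.mem_union, not_or] at hj
    obtain ⟨u, hu, v, hv, rfl⟩ := Submodule.mem_sup.mp hw
    rw [map_add, hz j hj.1 u hu, hz' j hj.2 v hv, add_zero]

/-- By the Leibniz rule, `f W' + W` is invariant. -/
theorem Recognizable.conv {f g : Series ι} (hf : Recognizable f) (hg : Recognizable g) :
    Recognizable (conv f g) := by
  classical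
  obtain ⟨W, J, hW, hfW, hinv, hz⟩ := hf
  obtain ⟨W', J', hW', hgW, hinv', hz'⟩ := hg
  refine ⟨W'.map (convLin f) ⊔ W, J ∪ J', inferInstance,
    Submodule.mem_sup_left (Submodule.mem_map_of_mem (f := convLin f) hgW), ?_, ?_⟩
  · intro j w hw
    obtain ⟨u, hu, v, hv, rfl⟩ := Submodule.mem_sup.mp hw
    obtain ⟨u, hu', rfl⟩ := Submodule.mem_map.mp hu
    have : shift [j] (convLin f u + v) =
        convLin f (shift [j] u) + (u [] • shift [j] f + shift [j] v) := by
      rw [map_add]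
      change shift [j] (NCFock.conv f u) + _ = NCFock.conv f _ + _
      rw [shift_conv, add_assoc]
    rw [this]
    exact Submodule.add_mem_sup (Submodule.mem_map_of_mem (f := convLin f) (hinv' j u hu'))
      (W.add_mem (W.smul_mem _ (hinv j f hfW)) (hinv j v hv))
  · intro j hj w hw
    simp only [Finset.mem_union, not_or] at hj
    obtain ⟨u, hu, v, hv, rfl⟩ := Submodule.mem_sup.mp hw
    obtain ⟨u, hu', rfl⟩ := Submodule.mem_map.mp hu
    have : shift [j] (convLin f u + v) =
        convLin f (shift [j] u) + (u [] • shift [j] f + shift [j] v) := by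
      rw [map_add]
      change shift [j] (NCFock.conv f u) + _ = NCFock.conv f _ + _
      rw [shift_conv, add_assoc]
    rw [this, hz j hj.1 f hfW, hz j hj.1 v hv, hz' j hj.2 u hu']
    simp

theorem nil_ne_zero_of_conv_eq {f g : Series ι} (h : conv f g = mono []) :
    f [] ≠ 0 ∧ g [] ≠ 0 := by
  have := congrFun h []
  rw [conv_nil] at this
  have h1 : f [] * g [] ≠ 0 := by rw [this]; simp [mono]
  exact ⟨left_ne_zero_of_mul h1, right_ne_zero_of_mul h1⟩

theorem conv_comm_of_inverse {f g : Series ι} (h : conv f g = mono []) :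
    conv g f = mono [] := by
  obtain ⟨k, hk⟩ := exists_right_inverse g (nil_ne_zero_of_conv_eq h).2
  have : f = k := by
    rw [← conv_mono_nil f, ← hk, ← conv_assoc, h, mono_nil_conv]
  rw [this, hk]

/-- Apply the Leibniz rule to `f g = 1`, whose right side is annihilated by translations, and
multiply by `g` on the left. -/
theorem shift_inverse {f g : Series ι} (h : conv f g = mono []) (j : ι) :
    shift [j] g = -(g [] • conv g (shift [j] f)) := by
  have h1 := congrArg (shift [j]) h
  rw [shift_conv, shift_mono_nil] at h1
  have h2 := congrArg (conv g) (eq_neg_of_add_eq_zero_left h1)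
  rw [← conv_assoc, conv_comm_of_inverse h, mono_nil_conv] at h2
  rw [h2, ← neg_smul, conv_smul_right, neg_smul]

/-- By `shift_inverse`, translation by a letter sends both `g` and `g W` into `g W`, so `ℂ g + g W`
is invariant. -/
theorem Recognizable.inverse {f g : Series ι} (hf : Recognizable f)
    (h : NCFock.conv f g = mono []) : Recognizable g := by
  obtain ⟨W, J, hW, hfW, hinv, hz⟩ := hf
  have key : ∀ j c u, shift [j] (c • g + convLin g u) =
      convLin g (-((c * g []) • shift [j] f) + (shift [j] u - (u [] * g []) • shift [j] f)) := by
    intro j c u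
    rw [map_add, map_smul, map_add, map_neg, map_sub, map_smul, map_smul]
    change _ + shift [j] (NCFock.conv g u) = -(_ • NCFock.conv g _) +
      (NCFock.conv g _ - _ • NCFock.conv g _)
    rw [shift_conv, shift_inverse h, mul_smul, mul_smul]
    simp only [smul_neg]
    abel
  refine ⟨Submodule.span ℂ {g} ⊔ W.map (convLin g), J, inferInstance,
    Submodule.mem_sup_left (Submodule.subset_span rfl), ?_, ?_⟩
  · intro j w hw
    obtain ⟨v, hv, u, hu, rfl⟩ := Submodule.mem_sup.mp hw
    obtain ⟨u, hu', rfl⟩ := Submodule.mem_map.mp hu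
    obtain ⟨c, rfl⟩ := Submodule.mem_span_singleton.mp hv
    rw [key j c u]
    refine Submodule.mem_sup_right (Submodule.mem_map_of_mem ?_)
    exact W.add_mem (W.neg_mem (W.smul_mem _ (hinv j f hfW)))
      (W.sub_mem (hinv j u hu') (W.smul_mem _ (hinv j f hfW)))
  · intro j hj w hw
    obtain ⟨v, hv, u, hu, rfl⟩ := Submodule.mem_sup.mp hw
    obtain ⟨u, hu', rfl⟩ := Submodule.mem_map.mp hu
    obtain ⟨c, rfl⟩ := Submodule.mem_span_singleton.mp hv
    rw [key j c u, hz j hj f hfW, hz j hj u hu']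
    simp

/-! ### Evaluation at the nilpotent point attached to a word -/

/-- The tuple of weighted shift matrices attached to a word. -/
noncomputable def wordPoint (ω : List ι) : Tuple ι (ω.length + 1) :=
  fun j => wordMat ω (mono [j])

theorem wordProd_wordPoint (ω α : List ι) :
    wordProd (wordPoint ω) α = wordMat ω (mono α) := by
  induction α with
  | nil => simp [wordProd, wordMat_one]
  | cons j α ih =>
    have : wordProd (wordPoint ω) (j :: α) = wordPoint ω j * wordProd (wordPoint ω) α := by
      simp [wordProd]
    rw [this, ih, wordPoint, ← wordMat_conv, mono_conv_mono]
    rfl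

theorem wordPoint_nil : wordPoint ([] : List ι) = 0 := by
  funext j
  ext a b
  have : a = b := Subsingleton.elim (α := Fin 1) a b
  subst this
  simp [wordPoint, wordMat_apply, mono]

/-- Among all monomials only the one at `ω` itself has a nonzero corner entry, so the corner
isolates a single coefficient. -/
theorem value_wordPoint {f : Series ι} {ω : List ι}
    {V : Matrix (Fin (ω.length + 1)) (Fin (ω.length + 1)) ℂ} (h : HasValue f (wordPoint ω) V) :
    V 0 (Fin.last _) = (1 / 2 : ℂ) ^ ω.length * f ω := by
  have h1 : HasSum (fun α => (f α • wordProd (wordPoint ω) α) 0 (Fin.last _))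
      (V 0 (Fin.last _)) := by
    have := (Pi.hasSum.mp ((Pi.hasSum.mp h) 0)) (Fin.last _)
    exact this
  refine h1.unique ?_
  have h2 : (1 / 2 : ℂ) ^ ω.length * f ω =
      (f ω • wordProd (wordPoint ω) ω) 0 (Fin.last _) := by
    rw [Matrix.smul_apply, wordProd_wordPoint, wordMat_zero_last]
    simp [mono, mul_comm]
  rw [h2]
  refine hasSum_single ω fun α hα => ?_
  rw [Matrix.smul_apply, wordProd_wordPoint, wordMat_zero_last]
  simp [mono, hα.symm]

theorem wordPoint_apply_eq_zero {ω : List ι} {j : ι} {a b : Fin (ω.length + 1)}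
    (h : ¬ ((b : ℕ) = a + 1 ∧ ω[(a : ℕ)]? = some j)) : wordPoint ω j a b = 0 := by
  have hb := b.2
  rw [wordPoint, wordMat_apply]
  split_ifs with hab
  · have hab' : (a : ℕ) ≤ b := hab
    have : (ω.drop a).take ((b : ℕ) - a) ≠ [j] := by
      intro h'
      have hl := congrArg List.length h'
      simp at hl
      apply h
      refine ⟨by omega, ?_⟩
      have := congrArg (fun l => l[0]?) h'
      rw [show (b : ℕ) - a = 1 by omega] at this
      simpa [List.getElem?_take] using this
    simp [mono, this]
  · rfl

theorem wordPoint_apply_eq {ω : List ι} {j : ι} {a b : Fin (ω.length + 1)}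
    (h : (b : ℕ) = a + 1 ∧ ω[(a : ℕ)]? = some j) : wordPoint ω j a b = 1 / 2 := by
  obtain ⟨h1, h2⟩ := h
  have hab : a ≤ b := Fin.le_def.mpr (by omega)
  rw [wordPoint, wordMat_apply, if_pos hab, show (b : ℕ) - a = 1 by omega]
  have : (ω.drop a).take 1 = [j] := by
    rw [List.take_one, List.head?_drop, h2]
    rfl
  rw [this]
  simp [mono]

theorem wordPoint_eq_zero {ω : List ι} {j : ι} (h : j ∉ ω) : wordPoint ω j = 0 := by
  ext a b
  refine wordPoint_apply_eq_zero fun h' => h ?_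
  exact List.mem_of_getElem? h'.2

/-- Each row has at most one nonzero entry over all letters, equal to `1/2`, and distinct rows use
distinct columns. The sum of the `Z_j Z_j^*` is therefore diagonal with entries `1/4` and `0`. -/
theorem wordPoint_mem_rowBall (ω : List ι) : wordPoint ω ∈ rowBall ι (ω.length + 1) := by
  classical
  have key : ∑ j ∈ ω.toFinset, wordPoint ω j * (wordPoint ω j).conjTranspose =
      Matrix.diagonal fun a : Fin (ω.length + 1) =>
        if (a : ℕ) < ω.length then (1 / 4 : ℂ) else 0 := by
    ext a b
    rw [Matrix.sum_apply]
    simp only [Matrix.mul_apply, Matrix.conjTranspose_apply]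
    by_cases hab : a = b
    · subst hab
      rw [Matrix.diagonal_apply_eq]
      split_ifs with ha
      · rw [Finset.sum_eq_single (ω[(a : ℕ)]), Finset.sum_eq_single (⟨a + 1, by omega⟩)]
        · rw [wordPoint_apply_eq (by simp)]
          norm_num
        · intro c _ hc
          rw [wordPoint_apply_eq_zero, zero_mul]
          rintro ⟨h1, -⟩
          exact hc (Fin.ext h1)
        · simp
        · intro j _ hj
          refine Finset.sum_eq_zero fun c _ => ?_
          rw [wordPoint_apply_eq_zero, zero_mul]
          rintro ⟨-, h2⟩
          rw [List.getElem?_eq_getElem ha] at h2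
          exact hj (Option.some.inj h2).symm
        · intro h
          exact absurd (List.mem_toFinset.mpr (List.getElem_mem ha)) h
      · refine Finset.sum_eq_zero fun j _ => Finset.sum_eq_zero fun c _ => ?_
        rw [wordPoint_apply_eq_zero, zero_mul]
        rintro ⟨h1, -⟩
        have := c.2
        omega
    · rw [Matrix.diagonal_apply_ne _ hab]
      refine Finset.sum_eq_zero fun j _ => Finset.sum_eq_zero fun c _ => ?_
      by_cases h1 : (c : ℕ) = a + 1
      · rw [wordPoint_apply_eq_zero (a := b), star_zero, mul_zero]
        rintro ⟨h2, -⟩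
        exact hab (Fin.ext (by omega))
      · rw [wordPoint_apply_eq_zero, zero_mul]
        exact fun h => h1 h.1
  refine ⟨_, hasSum_sum_of_ne_finset_zero (s := ω.toFinset) ?_, ?_⟩
  · intro j hj
    rw [wordPoint_eq_zero (by simpa using hj), zero_mul]
  · rw [key, ← Matrix.diagonal_one, Matrix.diagonal_sub]
    refine Matrix.PosDef.diagonal fun a => ?_
    split_ifs
    · norm_num
    · norm_num

/-- The value of a rational expression at the points attached to words is the value of a
recognizable series. -/
theorem RatExpr.exists_series (e : RatExpr ι) (he : e.InDom (0 : Tuple ι 1)) :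
    ∃ f : Series ι, Recognizable f ∧
      ∀ ω, e.InDom (wordPoint ω) ∧ e.eval (wordPoint ω) = wordMat ω f := by
  induction e with
  | scalar c =>
    exact ⟨c • mono [], recognizable_scalar c, fun ω => ⟨trivial, by
      rw [wordMat_smul, wordMat_one]; rfl⟩⟩
  | var j => exact ⟨mono [j], recognizable_var j, fun ω => ⟨trivial, rfl⟩⟩
  | add p q ihp ihq =>
    obtain ⟨f, hf, hf'⟩ := ihp he.1
    obtain ⟨g, hg, hg'⟩ := ihq he.2
    refine ⟨f + g, hf.add hg, fun ω => ⟨⟨(hf' ω).1, (hg' ω).1⟩, ?_⟩⟩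
    rw [wordMat_add, ← (hf' ω).2, ← (hg' ω).2]
    rfl
  | mul p q ihp ihq =>
    obtain ⟨f, hf, hf'⟩ := ihp he.1
    obtain ⟨g, hg, hg'⟩ := ihq he.2
    refine ⟨conv f g, hf.conv hg, fun ω => ⟨⟨(hf' ω).1, (hg' ω).1⟩, ?_⟩⟩
    rw [wordMat_conv, ← (hf' ω).2, ← (hg' ω).2]
    rfl
  | inv p ihp =>
    obtain ⟨f, hf, hf'⟩ := ihp he.1
    have h0 : f [] ≠ 0 := by
      -- The point attached to the empty word is the origin, so regularity at `0` says exactly that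
      -- the constant term is nonzero. This suffices for invertibility at every word point.
      have h1 : IsUnit (p.eval (0 : Tuple ι 1)) := he.2
      have h2 : p.eval (0 : Tuple ι 1) = wordMat [] f := by
        rw [← (hf' []).2, wordPoint_nil]
      rw [h2] at h1
      intro h3
      have h4 : wordMat [] f = 0 := by
        ext a b
        have : a = b := Subsingleton.elim (α := Fin 1) a b
        subst this
        simp [wordMat_apply, h3]
      rw [h4] at h1
      have : (0 : Matrix (Fin 1) (Fin 1) ℂ) = 1 := isUnit_zero_iff.mp h1
      have := congrFun (congrFun this 0) 0
      simp at this
    obtain ⟨g, hg⟩ := exists_right_inverse f h0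
    have hmul : ∀ ω, wordMat ω f * wordMat ω g = 1 := fun ω => by
      rw [← wordMat_conv, hg, wordMat_one]
    refine ⟨g, hf.inverse hg, fun ω => ⟨⟨(hf' ω).1, ?_⟩, ?_⟩⟩
    · rw [(hf' ω).2]
      exact (IsUnit.of_mul_eq_one _ (hmul ω))
    · change (p.eval (wordPoint ω))⁻¹ = _
      rw [(hf' ω).2]
      exact Matrix.inv_eq_right_inv (hmul ω)

/-- An expression regular at `0` is defined at every word point, and these points lie in the
row-ball. Comparing corner entries there identifies `r` with the recognizable series of the
expression. -/
theorem IsNCRational.recognizable {r : Series ι} (hr : IsNCRational r) : Recognizable r := by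
  obtain ⟨e, he, hval⟩ := hr
  obtain ⟨f, hf, hf'⟩ := e.exists_series he
  suffices r = f by rwa [this]
  funext ω
  have := value_wordPoint (hval _ _ (wordPoint_mem_rowBall ω) (hf' ω).1)
  rw [(hf' ω).2, wordMat_zero_last] at this
  exact (mul_left_cancel₀ (by positivity) this).symm

end Series

end NCFock

namespace NCFock

/-! ### Summation over words -/

section Words

open ENNReal

variable {ι : Type*}

/-- A word with a marked position is the same as a pair of words. -/
def splitEquiv (ι : Type*) : (Σ ω : List ι, Fin (ω.length + 1)) ≃ List ι × List ι where
  toFun p := (p.1.take p.2, p.1.drop p.2)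
  invFun q := ⟨q.1 ++ q.2, ⟨q.1.length, by simp⟩⟩
  left_inv := by
    rintro ⟨ω, k, hk⟩
    have h1 : ω.take k ++ ω.drop k = ω := List.take_append_drop k ω
    have h2 : (ω.take k).length = k := by simp; omega
    refine Sigma.ext h1 ?_
    refine (Fin.heq_ext_iff (by simp)).mpr h2
  right_inv := by
    rintro ⟨α, β⟩
    simp

/-- A word is empty or has a last letter. -/
def concatEquiv (ι : Type*) : Option (List ι × ι) ≃ List ι where
  toFun p := p.elim [] fun q => q.1 ++ [q.2]
  invFun ω := if h : ω = [] then none else some (ω.dropLast, ω.getLast h)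
  left_inv := by
    rintro (_ | ⟨α, j⟩) <;> simp
  right_inv ω := by
    by_cases h : ω = []
    · simp [h]
    · simp [h, List.dropLast_append_getLast]

theorem tsum_split (F : List ι → List ι → ℝ≥0∞) :
    ∑' ω : List ι, ∑ k ∈ Finset.range (ω.length + 1), F (ω.take k) (ω.drop k) =
      ∑' α, ∑' β, F α β := by
  rw [← ENNReal.tsum_prod, ← (splitEquiv ι).tsum_eq (fun p => F p.1 p.2), ENNReal.tsum_sigma']
  refine tsum_congr fun ω => ?_
  rw [tsum_fintype, Finset.sum_range]
  rfl

theorem hasSum_split {F : List ι → List ι → ℂ} {s : ℂ}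
    (h : HasSum (fun p : List ι × List ι => F p.1 p.2) s) :
    HasSum (fun ω : List ι => ∑ k ∈ Finset.range (ω.length + 1), F (ω.take k) (ω.drop k)) s := by
  have h1 := (splitEquiv ι).hasSum_iff.mpr h
  refine h1.sigma fun ω => ?_
  rw [Finset.sum_range]
  exact hasSum_fintype _

/-- Splitting off the last letter is the telescoping device behind the Poisson identity and the
Neumann series for `(1 - P)⁻¹`. -/
theorem hasSum_concat_iff {M : Type*} [AddCommGroup M] [TopologicalSpace M]
    [IsTopologicalAddGroup M] {F : List ι → M} {s : M} :
    HasSum (fun p : List ι × ι => F (p.1 ++ [p.2])) s ↔ HasSum F (F [] + s) := by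
  classical
  rw [← (concatEquiv ι).hasSum_iff]
  have h := (Function.Embedding.some (α := List ι × ι)).injective.hasSum_iff
    (f := Function.update (F ∘ concatEquiv ι) none 0) (a := s) (by
      rintro (_ | q) hq
      · simp
      · exact absurd ⟨q, rfl⟩ hq)
  have h1 : (Function.update (F ∘ concatEquiv ι) none 0) ∘
      (Function.Embedding.some (α := List ι × ι)) = fun p => F (p.1 ++ [p.2]) := by
    funext p
    rfl
  rw [h1] at h
  rw [h]
  constructor
  · intro h2
    have h3 := h2.update none (F [])
    rw [Function.update_idem] at h3
    have h4 : Function.update (F ∘ concatEquiv ι) none (F []) = F ∘ concatEquiv ι :=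
      Function.update_eq_self none _
    rw [h4] at h3
    simpa using h3
  · intro h2
    have := h2.update none 0
    simpa [add_comm, concatEquiv] using this

theorem sq_sum_mul_le {κ : Type*} (s : Finset κ) (a b : κ → ℝ≥0∞) :
    (∑ i ∈ s, a i * b i) ^ 2 ≤ (∑ i ∈ s, a i ^ 2) * ∑ i ∈ s, b i ^ 2 := by
  have h := ENNReal.inner_le_Lp_mul_Lq s a b Real.HolderConjugate.two_two
  have h2 : ∀ x : ℝ≥0∞, (x ^ (1 / 2 : ℝ)) ^ 2 = x := fun x => by
    rw [← ENNReal.rpow_natCast, ← ENNReal.rpow_mul]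
    norm_num
  calc (∑ i ∈ s, a i * b i) ^ 2
      ≤ ((∑ i ∈ s, a i ^ (2 : ℝ)) ^ (1 / 2 : ℝ) * (∑ i ∈ s, b i ^ (2 : ℝ)) ^ (1 / 2 : ℝ)) ^ 2 := by
        gcongr
    _ = _ := by
        rw [mul_pow, h2, h2]
        simp only [ENNReal.rpow_ofNat]

/-- The squared norm of the part of `f` of degree at least `K`. -/
noncomputable def tail (K : ℕ) (f : Series ι) : ℝ≥0∞ :=
  ∑' ω : List ι, if K ≤ ω.length then ‖f ω‖ₑ ^ 2 else 0

theorem tail_zero (f : Series ι) : tail 0 f = ∑' ω, ‖f ω‖ₑ ^ 2 := by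
  simp [tail]

theorem tail_anti (f : Series ι) {K L : ℕ} (h : K ≤ L) : tail L f ≤ tail K f := by
  refine ENNReal.tsum_le_tsum fun ω => ?_
  split_ifs with h1 h2
  · exact le_rfl
  · exact absurd (h.trans h1) h2
  · exact zero_le
  · exact le_rfl

theorem summable_sq_iff {κ : Type*} (f : κ → ℂ) :
    Summable (fun i => ‖f i‖ ^ 2) ↔ ∑' i, ‖f i‖ₑ ^ 2 ≠ ⊤ := by
  have : ∀ i, ‖f i‖ₑ ^ 2 = ((‖f i‖₊ ^ 2 : NNReal) : ℝ≥0∞) := fun i => by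
    rw [ENNReal.coe_pow]; rfl
  simp only [this]
  rw [ENNReal.tsum_coe_ne_top_iff_summable, ← NNReal.summable_coe]
  simp

theorem memlp_iff {κ : Type*} (f : κ → ℂ) : Memℓp f 2 ↔ ∑' i, ‖f i‖ₑ ^ 2 ≠ ⊤ := by
  rw [← summable_sq_iff, memℓp_gen_iff (by norm_num)]
  simp

theorem enorm_sq_eq_tail (h : Fock ι) : ‖h‖ₑ ^ 2 = tail 0 h := by
  have h1 := lp.norm_rpow_eq_tsum (p := 2) (by norm_num) h
  have h2 : ‖h‖ ^ 2 = ∑' ω, ‖h ω‖ ^ 2 := by simpa using h1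
  have h3 : Summable fun ω => ‖h ω‖ ^ 2 := (summable_sq_iff _).mpr ((memlp_iff _).mp h.2)
  rw [tail_zero, ← ofReal_norm, ← ENNReal.ofReal_pow (norm_nonneg _), h2,
    ENNReal.ofReal_tsum_of_nonneg (fun _ => by positivity) h3]
  refine tsum_congr fun ω => ?_
  rw [ENNReal.ofReal_pow (norm_nonneg _), ofReal_norm]

theorem tail_zero_ne_top (h : Fock ι) : tail 0 h ≠ ⊤ := by
  rw [tail_zero]
  exact (memlp_iff _).mp h.2

/-- A word of length at least `K + m` is uniquely `β α` with `|α| = m` and `|β| ≥ K`. -/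
theorem tail_add (K m : ℕ) (f : Series ι) :
    tail (K + m) f = ∑' α : List ι, if α.length = m then tail K (shift α f) else 0 := by
  have h := tsum_split (ι := ι) fun β α =>
    if K ≤ β.length ∧ α.length = m then ‖f (β ++ α)‖ₑ ^ 2 else 0
  rw [ENNReal.tsum_comm] at h
  calc tail (K + m) f = _ := ?_
    _ = _ := h
    _ = _ := ?_
  · refine tsum_congr fun ω => ?_
    simp only [List.take_append_drop, List.length_take, List.length_drop]
    split_ifs with h1
    · rw [Finset.sum_eq_single (ω.length - m)]
      · rw [if_pos (by omega)]
      · intro k hk hne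
        rw [Finset.mem_range] at hk
        rw [if_neg (by omega)]
      · intro h2
        rw [Finset.mem_range] at h2
        omega
    · refine (Finset.sum_eq_zero fun k hk => ?_).symm
      rw [Finset.mem_range] at hk
      rw [if_neg (by omega)]
  · refine tsum_congr fun α => ?_
    by_cases h1 : α.length = m
    · simp [h1, tail]
    · simp [h1]

theorem exists_tail_le {f : Series ι} (hf : tail 0 f ≠ ⊤) {δ : ℝ≥0∞} (hδ : 0 < δ) :
    ∃ K, tail K f ≤ δ := by
  rw [tail_zero] at hf
  have h := ENNReal.tendsto_tsum_compl_atTop_zero hf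
  obtain ⟨s, hs⟩ := (h.eventually (ge_mem_nhds hδ)).exists
  refine ⟨s.sup List.length + 1, le_trans ?_ hs⟩
  rw [tail, ← tsum_subtype_eq_of_support_subset (s := {x | x ∉ s})]
  · refine ENNReal.tsum_le_tsum fun ω => ?_
    split_ifs
    · exact le_rfl
    · exact zero_le
  · intro ω hω hs'
    apply hω
    have : ω.length ≤ s.sup List.length := Finset.le_sup (f := List.length) hs'
    exact if_neg (by omega)

/-! ### Geometric decay -/

/-- The squared norm of `f` with the weight `s ^ |ω|`. -/
noncomputable def weighted (s : ℝ≥0∞) (f : Series ι) : ℝ≥0∞ :=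
  ∑' ω : List ι, (s ^ ω.length * ‖f ω‖ₑ) ^ 2

theorem tail_zero_le_weighted {s : ℝ≥0∞} (hs : 1 < s) (f : Series ι) :
    tail 0 f ≤ weighted s f := by
  rw [tail_zero]
  refine ENNReal.tsum_le_tsum fun ω => ?_
  gcongr
  exact le_mul_of_one_le_left (zero_le) (one_le_pow₀ hs.le)

/-- The sum of the geometric series with ratio `s⁻²`. -/
noncomputable def geomConst (s : ℝ≥0∞) : ℝ≥0∞ := (1 - (s⁻¹) ^ 2)⁻¹

theorem geomConst_ne_top {s : ℝ≥0∞} (hs : 1 < s) : geomConst s ≠ ⊤ := by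
  rw [geomConst, ENNReal.inv_ne_top]
  refine (tsub_pos_of_lt ?_).ne'
  exact pow_lt_one₀ (zero_le) (ENNReal.inv_lt_one.mpr hs) (by norm_num)

theorem sum_geom_le (s : ℝ≥0∞) (n : ℕ) :
    ∑ k ∈ Finset.range n, ((s⁻¹) ^ k) ^ 2 ≤ geomConst s := by
  rw [geomConst, ← ENNReal.tsum_geometric]
  simp only [← pow_mul, mul_comm _ 2]
  simp only [pow_mul]
  exact ENNReal.sum_le_tsum _

theorem sum_geom_reflect_le {s : ℝ≥0∞} (hs : 1 < s) (hs' : s ≠ ⊤) (n : ℕ) :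
    ∑ k ∈ Finset.range (n + 1), (s ^ (n - k)) ^ 2 ≤ geomConst s * (s ^ n) ^ 2 := by
  have h0 : s ≠ 0 := (zero_lt_one.trans hs).ne'
  calc _ = ∑ k ∈ Finset.range (n + 1), ((s⁻¹) ^ k) ^ 2 * (s ^ n) ^ 2 := by
        refine Finset.sum_congr rfl fun k hk => ?_
        rw [Finset.mem_range] at hk
        rw [← mul_pow]
        congr 1
        obtain ⟨m, rfl⟩ : ∃ m, n = k + m := ⟨n - k, by omega⟩
        rw [pow_add, ← mul_assoc, ← mul_pow, ENNReal.inv_mul_cancel h0 hs']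
        simp
    _ ≤ _ := by
        rw [← Finset.sum_mul]
        gcongr
        exact sum_geom_le s _

/-- Invariance lets the one-step contraction act on every translate of `w` by a word of length `i *
K`; `tail_add` reassembles the result. -/
theorem tail_mul_le {W : Set (Series ι)} (hinv : ∀ ν, ∀ w ∈ W, shift ν w ∈ W) {K : ℕ}
    (hK : ∀ w ∈ W, tail K w ≤ 2⁻¹ * tail 0 w) (i : ℕ) :
    ∀ w ∈ W, tail (i * K) w ≤ (2⁻¹) ^ i * tail 0 w := by
  induction i with
  | zero => intro w _; simp
  | succ i ih =>
    intro w hw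
    rw [add_mul, one_mul, add_comm, tail_add, pow_succ', mul_assoc]
    refine le_trans ?_ (mul_le_mul_right (ih w hw) _)
    have h := tail_add 0 (i * K) w
    rw [zero_add] at h
    rw [h, ← ENNReal.tsum_mul_left]
    refine ENNReal.tsum_le_tsum fun α => ?_
    split_ifs
    · exact hK _ (hinv α w hw)
    · simp

theorem exists_weighted_ne_top {W : Set (Series ι)} (hinv : ∀ ν, ∀ w ∈ W, shift ν w ∈ W)
    (hfin : ∀ w ∈ W, tail 0 w ≠ ⊤) {K : ℕ} (hK0 : K ≠ 0)
    (hK : ∀ w ∈ W, tail K w ≤ 2⁻¹ * tail 0 w) :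
    ∃ s : ℝ≥0∞, 1 < s ∧ s ≠ ⊤ ∧ ∀ w ∈ W, weighted s w ≠ ⊤ := by
  have hK0' : (0 : ℝ) < K := by exact_mod_cast Nat.pos_of_ne_zero hK0
  -- Any `q` strictly between `1` and `2` works: `q > 1` gives a weight `s > 1` with `s ^ (2 * K) =
  -- q`, and `q / 2 < 1` makes the sum over blocks of length `K` converge.
  let q : ℝ≥0∞ := 3 / 2
  have hq : 1 < q := by
    rw [ENNReal.lt_div_iff_mul_lt] <;> norm_num
  have hq' : q ≠ ⊤ := ENNReal.div_ne_top (by norm_num) (by norm_num)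
  let s : ℝ≥0∞ := q ^ (1 / (2 * K) : ℝ)
  have hs : s ^ (2 * K) = q := by
    rw [← ENNReal.rpow_natCast, ← ENNReal.rpow_mul]
    push_cast
    rw [one_div_mul_cancel (by positivity), ENNReal.rpow_one]
  have h1s : 1 < s := ENNReal.one_lt_rpow hq (by positivity)
  refine ⟨s, h1s, ENNReal.rpow_ne_top_of_nonneg (by positivity) hq', fun w hw => ?_⟩
  have hpt : ∀ ω : List ι, (s ^ ω.length * ‖w ω‖ₑ) ^ 2 ≤
      q * ∑' i : ℕ, q ^ i * if i * K ≤ ω.length then ‖w ω‖ₑ ^ 2 else 0 := by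
    intro ω
    set n := ω.length / K with hn
    have h1 : n * K ≤ ω.length := Nat.div_mul_le_self _ _
    have h2 : ω.length ≤ (n + 1) * K := by
      have := Nat.div_add_mod ω.length K
      have := Nat.mod_lt ω.length (Nat.pos_of_ne_zero hK0)
      rw [add_mul, one_mul, mul_comm]
      rw [← hn] at *
      omega
    calc (s ^ ω.length * ‖w ω‖ₑ) ^ 2 ≤ (s ^ ((n + 1) * K) * ‖w ω‖ₑ) ^ 2 := by
          gcongr
          exact h1s.le
      _ = q ^ (n + 1) * ‖w ω‖ₑ ^ 2 := by
          rw [mul_pow, ← hs, ← pow_mul, ← pow_mul]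
          congr 2
          ring
      _ = q * (q ^ n * if n * K ≤ ω.length then ‖w ω‖ₑ ^ 2 else 0) := by
          rw [if_pos h1, pow_succ', mul_assoc]
      _ ≤ _ := by
          gcongr
          exact ENNReal.le_tsum (f := fun i : ℕ => q ^ i *
            if i * K ≤ ω.length then ‖w ω‖ₑ ^ 2 else 0) n
  have : weighted s w ≤ q * ((1 - q * 2⁻¹)⁻¹ * tail 0 w) := by
    calc weighted s w ≤ _ := ENNReal.tsum_le_tsum hpt
      _ = q * ∑' i : ℕ, q ^ i * tail (i * K) w := by
          rw [ENNReal.tsum_mul_left, ENNReal.tsum_comm]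
          simp only [ENNReal.tsum_mul_left]
          rfl
      _ ≤ q * ∑' i : ℕ, (q * 2⁻¹) ^ i * tail 0 w := by
          refine mul_le_mul_right (ENNReal.tsum_le_tsum fun i => ?_) _
          rw [mul_pow, mul_assoc]
          gcongr
          exact tail_mul_le hinv hK i w hw
      _ = _ := by rw [ENNReal.tsum_mul_right, ENNReal.tsum_geometric]
  refine ne_top_of_le_ne_top ?_ this
  refine ENNReal.mul_ne_top hq' (ENNReal.mul_ne_top ?_ (hfin w hw))
  rw [ENNReal.inv_ne_top]
  refine (tsub_pos_of_lt ?_).ne'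
  rw [← div_eq_mul_inv, ENNReal.div_lt_iff (by simp) (by simp), one_mul,
    ENNReal.div_lt_iff (by simp) (by simp)]
  norm_num

/-- Cauchy–Schwarz on each coefficient of the product, after inserting `s⁻ᵏ sᵏ`: the factors `s⁻ᵏ`
contribute a convergent geometric series, and what remains sums to `weighted s f * ‖h‖²`. -/
theorem mem_Hinf_of_weighted {s : ℝ≥0∞} (hs : 1 < s) (hs' : s ≠ ⊤) {f : Series ι}
    (hf : weighted s f ≠ ⊤) : f ∈ Hinf ι := by
  intro h
  have h0 : s ≠ 0 := (zero_lt_one.trans hs).ne'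
  rw [memlp_iff]
  have hpt : ∀ ω : List ι, ‖conv f h ω‖ₑ ^ 2 ≤ geomConst s *
      ∑ k ∈ Finset.range (ω.length + 1),
        (s ^ (ω.take k).length * ‖f (ω.take k)‖ₑ) ^ 2 * ‖h (ω.drop k)‖ₑ ^ 2 := by
    intro ω
    calc ‖conv f h ω‖ₑ ^ 2 ≤ (∑ k ∈ Finset.range (ω.length + 1),
          (s⁻¹) ^ k * (s ^ (ω.take k).length * ‖f (ω.take k)‖ₑ * ‖h (ω.drop k)‖ₑ)) ^ 2 := by
          gcongr
          refine (enorm_sum_le _ _).trans (Finset.sum_le_sum fun k hk => ?_)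
          rw [Finset.mem_range] at hk
          rw [enorm_mul, List.length_take, min_eq_left (by omega), ← mul_assoc, ← mul_assoc,
            ← mul_pow, ENNReal.inv_mul_cancel h0 hs']
          simp
      _ ≤ _ := sq_sum_mul_le _ _ _
      _ ≤ _ := by
          gcongr with k hk
          · exact sum_geom_le _ _
          · rw [mul_pow _ ‖h (ω.drop k)‖ₑ]
  refine ne_top_of_le_ne_top ?_ (ENNReal.tsum_le_tsum hpt)
  rw [ENNReal.tsum_mul_left, tsum_split fun α β => (s ^ α.length * ‖f α‖ₑ) ^ 2 * ‖h β‖ₑ ^ 2]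
  simp only [ENNReal.tsum_mul_left, ENNReal.tsum_mul_right]
  refine ENNReal.mul_ne_top (geomConst_ne_top hs) (ENNReal.mul_ne_top hf ?_)
  exact (memlp_iff _).mp h.2

/-- The terms `conj (x_{α β}) f_α h_β` are summable if `f` decays geometrically. -/
theorem summable_pairing {s : ℝ≥0∞} (hs : 1 < s) (hs' : s ≠ ⊤) {f h x : Series ι}
    (hf : weighted s f ≠ ⊤) (hh : tail 0 h ≠ ⊤) (hx : tail 0 x ≠ ⊤) :
    Summable fun p : List ι × List ι => star (x (p.1 ++ p.2)) * (f p.1 * h p.2) := by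
  have h0 : s ≠ 0 := (zero_lt_one.trans hs).ne'
  have key : ∑' p : List ι × List ι, ‖star (x (p.1 ++ p.2)) * (f p.1 * h p.2)‖ₑ ≠ ⊤ := by
    -- The factor `s⁻¹` to the power `|α|` goes to `x`, where it makes the sum over all cuts of a
    -- word finite, and its inverse goes to `f`.
    have hpt : ∀ α β, ‖star (x (α ++ β)) * (f α * h β)‖ₑ ≤
        ((s⁻¹) ^ α.length * ‖x (α ++ β)‖ₑ) ^ 2 + (s ^ α.length * ‖f α‖ₑ) ^ 2 * ‖h β‖ₑ ^ 2 := by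
      intro α β
      set a := (s⁻¹) ^ α.length * ‖x (α ++ β)‖ₑ
      set b := s ^ α.length * ‖f α‖ₑ * ‖h β‖ₑ
      have hab : ‖star (x (α ++ β)) * (f α * h β)‖ₑ = a * b := by
        have : ‖star (x (α ++ β))‖ₑ = ‖x (α ++ β)‖ₑ := by
          rw [← ofReal_norm, norm_star, ofReal_norm]
        rw [enorm_mul, enorm_mul, this]
        calc ‖x (α ++ β)‖ₑ * (‖f α‖ₑ * ‖h β‖ₑ)
            = (s⁻¹ * s) ^ α.length * (‖x (α ++ β)‖ₑ * (‖f α‖ₑ * ‖h β‖ₑ)) := by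
              rw [ENNReal.inv_mul_cancel h0 hs']; simp
          _ = a * b := by rw [mul_pow]; ring
      rw [hab, ← mul_pow]
      rcases le_total a b with h | h
      · exact le_trans (by rw [sq]; gcongr) le_add_self
      · exact le_trans (by rw [sq]; gcongr) le_self_add
    rw [ENNReal.tsum_prod (f := fun α β => ‖star (x (α ++ β)) * (f α * h β)‖ₑ)]
    refine ne_top_of_le_ne_top ?_
      (ENNReal.tsum_le_tsum fun α => ENNReal.tsum_le_tsum fun β => hpt α β)
    simp only [ENNReal.tsum_add]
    refine ENNReal.add_ne_top.mpr ⟨?_, ?_⟩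
    · rw [← tsum_split fun α β => ((s⁻¹) ^ α.length * ‖x (α ++ β)‖ₑ) ^ 2]
      refine ne_top_of_le_ne_top (ENNReal.mul_ne_top (geomConst_ne_top hs) hx) ?_
      rw [tail_zero, ← ENNReal.tsum_mul_left]
      refine ENNReal.tsum_le_tsum fun ω => ?_
      simp only [List.take_append_drop, mul_pow _ ‖x ω‖ₑ, ← Finset.sum_mul]
      gcongr
      refine le_trans (le_of_eq (Finset.sum_congr rfl fun k hk => ?_)) (sum_geom_le s _)
      rw [Finset.mem_range] at hk
      rw [List.length_take, min_eq_left (by omega)]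
    · simp only [ENNReal.tsum_mul_left, ENNReal.tsum_mul_right]
      rw [tail_zero] at hh
      exact ENNReal.mul_ne_top hf hh
  refine Summable.of_enorm ?_
  exact key

/-! ### Translations of the Fock space -/

theorem memlp_shift (ν : List ι) (h : Fock ι) : Memℓp (shift ν h) 2 := by
  rw [memlp_iff]
  exact ne_top_of_le_ne_top ((memlp_iff _).mp h.2)
    (ENNReal.tsum_comp_le_tsum_of_injective (List.append_left_injective ν) fun ω => ‖h ω‖ₑ ^ 2)

/-- Right translation as a linear map of the Fock space. -/
def fockShift (ν : List ι) : Fock ι →ₗ[ℂ] Fock ι where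
  toFun h := ⟨shift ν h, memlp_shift ν h⟩
  map_add' _ _ := rfl
  map_smul' _ _ := rfl

theorem fockShift_fockShift (ν μ : List ι) (h : Fock ι) :
    fockShift ν (fockShift μ h) = fockShift (ν ++ μ) h :=
  Subtype.ext (shift_shift ν μ h)

theorem fockShift_nil (h : Fock ι) : fockShift [] h = h := by
  apply Subtype.ext
  funext α
  change h (α ++ []) = h α
  simp

/-! ### Uniform decay on finite-dimensional spaces. -/

theorem exists_coord_bound (W : Submodule ℂ (Fock ι)) {n : ℕ}
    (b : Module.Basis (Fin n) ℂ W) :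
    ∃ M : ℝ≥0∞, M ≠ ⊤ ∧ ∀ (w : W) i, ‖b.repr w i‖ₑ ≤ M * ‖(w : Fock ι)‖ₑ := by
  have : FiniteDimensional ℂ W := Module.Finite.of_basis b
  let T : W →L[ℂ] (Fin n → ℂ) := b.equivFunL
  refine ⟨‖T‖ₑ, by simp, fun w i => ?_⟩
  have h1 : ‖T w‖ₑ ≤ ‖T‖ₑ * ‖w‖ₑ := T.le_opENorm w
  refine le_trans ?_ h1
  have h2 : ‖T w i‖ ≤ ‖T w‖ := norm_le_pi_norm _ i
  rw [← ofReal_norm, ← ofReal_norm]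
  exact ENNReal.ofReal_le_ofReal h2

/-- The tails of finitely many basis vectors are simultaneously small, and coordinates are bounded
by the norm; so one `K` serves all of `W`. -/
theorem exists_tail_contraction (W : Submodule ℂ (Fock ι)) [FiniteDimensional ℂ W] :
    ∃ K ≠ 0, ∀ w ∈ W, tail K (w : Fock ι) ≤ 2⁻¹ * tail 0 (w : Fock ι) := by
  obtain ⟨n, ⟨b⟩⟩ : ∃ n, Nonempty (Module.Basis (Fin n) ℂ W) := ⟨_, ⟨Module.finBasis ℂ W⟩⟩
  obtain ⟨M, hM, hb⟩ := exists_coord_bound W b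
  have hC : (n : ℝ≥0∞) * M ^ 2 * n ≠ ⊤ :=
    ENNReal.mul_ne_top (ENNReal.mul_ne_top (by simp) (ENNReal.pow_ne_top hM)) (by simp)
  -- `n * M ^ 2` bounds the sum of squared coordinates relative to the squared norm; the last `n`
  -- counts the basis tails.
  set C : ℝ≥0∞ := (n : ℝ≥0∞) * M ^ 2 * n
  have hδ : (0 : ℝ≥0∞) < 2⁻¹ * C⁻¹ := ENNReal.mul_pos (by simp) (by simpa using hC)
  choose K hK using fun i => exists_tail_le (tail_zero_ne_top (b i : Fock ι)) hδ
  refine ⟨Finset.univ.sup K + 1, by simp, fun w hw => ?_⟩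
  set L := Finset.univ.sup K + 1
  have hL : ∀ i, tail L (b i : Fock ι) ≤ 2⁻¹ * C⁻¹ := fun i =>
    (tail_anti _ ((Finset.le_sup (Finset.mem_univ i)).trans (Nat.le_succ _))).trans (hK i)
  have hpt : ∀ ω, ‖w ω‖ₑ ^ 2 ≤ n * M ^ 2 * tail 0 w * ∑ i, ‖(b i : Fock ι) ω‖ₑ ^ 2 := by
    intro ω
    have h1 : w = ∑ i, b.repr ⟨w, hw⟩ i • (b i : Fock ι) := by
      have := congrArg W.subtype (b.sum_repr ⟨w, hw⟩)
      rw [map_sum] at this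
      exact this.symm
    have h2 : w ω = ∑ i, b.repr ⟨w, hw⟩ i * (b i : Fock ι) ω := by
      conv_lhs => rw [h1]
      rw [lp.coeFn_sum, Finset.sum_apply]
      rfl
    calc ‖w ω‖ₑ ^ 2 ≤ (∑ i, ‖b.repr ⟨w, hw⟩ i‖ₑ * ‖(b i : Fock ι) ω‖ₑ) ^ 2 := by
          rw [h2]
          gcongr
          refine (enorm_sum_le _ _).trans (le_of_eq ?_)
          simp only [enorm_mul]
      _ ≤ _ := sq_sum_mul_le _ _ _
      _ ≤ _ := by
          gcongr
          rw [mul_assoc, ← enorm_sq_eq_tail, ← mul_pow]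
          calc _ ≤ ∑ _i : Fin n, (M * ‖w‖ₑ) ^ 2 :=
                Finset.sum_le_sum fun i _ => by gcongr; exact hb ⟨w, hw⟩ i
            _ = _ := by simp
  have h3 : tail L w ≤ n * M ^ 2 * tail 0 w * ∑ i, tail L (b i : Fock ι) := by
    calc tail L w ≤ ∑' ω : List ι, n * M ^ 2 * tail 0 w *
          ∑ i, if L ≤ ω.length then ‖(b i : Fock ι) ω‖ₑ ^ 2 else 0 := by
          refine ENNReal.tsum_le_tsum fun ω => ?_
          split_ifs
          · exact hpt ω
          · exact zero_le
      _ = _ := by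
          rw [ENNReal.tsum_mul_left]
          congr 1
          exact Summable.tsum_finsetSum fun i _ => ENNReal.summable
  refine h3.trans ?_
  calc _ ≤ n * M ^ 2 * tail 0 w * ∑ _i : Fin n, (2⁻¹ * C⁻¹) := by
        gcongr
        exact hL _
    _ = 2⁻¹ * tail 0 w * (C * C⁻¹) := by
        simp only [Finset.sum_const, Finset.card_univ, Fintype.card_fin, nsmul_eq_mul, C]
        ring
    _ ≤ _ := by
        refine mul_le_of_le_one_right (zero_le) (ENNReal.mul_inv_le_one _)

/-- The span of all right translates of `r`. -/
noncomputable def orbitSpan (r : Fock ι) : Submodule ℂ (Fock ι) :=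
  Submodule.span ℂ (Set.range fun ν => fockShift ν r)

theorem fockShift_mem_orbitSpan (r : Fock ι) (ν : List ι) {w : Fock ι} (hw : w ∈ orbitSpan r) :
    fockShift ν w ∈ orbitSpan r := by
  have : orbitSpan r ≤ (orbitSpan r).comap (fockShift ν) := by
    refine Submodule.span_le.mpr ?_
    rintro _ ⟨μ, rfl⟩
    change fockShift ν (fockShift μ r) ∈ orbitSpan r
    rw [fockShift_fockShift]
    exact Submodule.subset_span ⟨_, rfl⟩
  exact this hw

theorem exists_weighted_orbitSpan (r : Fock ι) [FiniteDimensional ℂ (orbitSpan r)] :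
    ∃ s : ℝ≥0∞, 1 < s ∧ s ≠ ⊤ ∧ ∀ w ∈ orbitSpan r, weighted s (w : Fock ι) ≠ ⊤ := by
  obtain ⟨K, hK0, hK⟩ := exists_tail_contraction (orbitSpan r)
  obtain ⟨s, h1, h2, h3⟩ := exists_weighted_ne_top
    (W := (fun w : Fock ι => (w : Series ι)) '' (orbitSpan r : Set (Fock ι))) (K := K)
    (by
      rintro ν _ ⟨w, hw, rfl⟩
      exact ⟨fockShift ν w, fockShift_mem_orbitSpan r ν hw, rfl⟩)
    (by
      rintro _ ⟨w, hw, rfl⟩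
      exact tail_zero_ne_top w) hK0
    (by
      rintro _ ⟨w, hw, rfl⟩
      exact hK w hw)
  exact ⟨s, h1, h2, fun w hw => h3 _ ⟨w, hw, rfl⟩⟩

/-- Each coefficient at `ω` occurs once per suffix, with weights forming a geometric sum dominated
by its largest term. This bounds both the state matrices and the coefficients of `H`. -/
theorem tsum_weighted_tail_shift_ne_top {s : ℝ≥0∞} (hs : 1 < s) (hs' : s ≠ ⊤) {f : Series ι}
    (hf : weighted s f ≠ ⊤) :
    ∑' ν : List ι, (s ^ ν.length) ^ 2 * tail 0 (shift ν f) ≠ ⊤ := by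
  have h := tsum_split (ι := ι) fun β α => (s ^ α.length) ^ 2 * ‖f (β ++ α)‖ₑ ^ 2
  rw [ENNReal.tsum_comm] at h
  simp only [ENNReal.tsum_mul_left] at h
  simp only [tail_zero, shift_apply]
  rw [← h]
  refine ne_top_of_le_ne_top (ENNReal.mul_ne_top (geomConst_ne_top hs) hf) ?_
  rw [weighted, ← ENNReal.tsum_mul_left]
  refine ENNReal.tsum_le_tsum fun ω => ?_
  simp only [List.take_append_drop, List.length_drop, ← Finset.sum_mul]
  rw [mul_pow, ← mul_assoc]
  gcongr
  exact sum_geom_reflect_le hs hs' _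

end Words

end NCFock

namespace NCFock

/-! ### Points of the row-ball -/

section RowBall

open ENNReal

variable {ι : Type*}

theorem concat_injective : Function.Injective fun p : List ι × ι => p.1 ++ [p.2] := by
  rintro ⟨α, i⟩ ⟨β, j⟩ h
  have h' := List.append_inj' h rfl
  simp only [List.cons.injEq, and_true] at h'
  exact Prod.ext h'.1 h'.2

theorem tsum_concat (F : List ι → ℝ≥0∞) :
    ∑' ω, F ω = F [] + ∑' α, ∑' j, F (α ++ [j]) := by
  classical
  rw [ENNReal.tsum_eq_add_tsum_ite []]
  congr 1
  rw [← ENNReal.tsum_prod, ← concat_injective.tsum_eq]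
  · refine tsum_congr fun p => ?_
    simp
  · intro ω hω
    rcases List.eq_nil_or_concat ω with rfl | ⟨α, j, rfl⟩
    · simp at hω
    · exact ⟨(α, j), by simp⟩

theorem tsum_ne_top_of_geometric {b : List ι → ℝ≥0∞} {ρ : ℝ≥0∞} (hρ : ρ < 1) (h0 : b [] ≠ ⊤)
    (h : ∀ ω, ∑' j, b (ω ++ [j]) ≤ ρ * b ω) : ∑' ω, b ω ≠ ⊤ := by
  have key : ∀ k, ∑' ω, (if ω.length < k then b ω else 0) ≤
      b [] * ∑ i ∈ Finset.range k, ρ ^ i := by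
    intro k
    induction k with
    | zero => simp
    | succ k ih =>
      rw [tsum_concat, Finset.sum_range_succ', pow_zero, mul_add, mul_one, add_comm]
      gcongr
      · calc ∑' (α : List ι), ∑' j, (if (α ++ [j]).length < k + 1 then b (α ++ [j]) else 0)
            ≤ ∑' (α : List ι), ρ * (if α.length < k then b α else 0) := by
              refine ENNReal.tsum_le_tsum fun α => ?_
              simp only [List.length_append, List.length_singleton, add_lt_add_iff_right]
              split_ifs
              · exact h α
              · simp
          _ ≤ ρ * (b [] * ∑ i ∈ Finset.range k, ρ ^ i) := by
              rw [ENNReal.tsum_mul_left]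
              gcongr
          _ = _ := by
              simp only [pow_succ, ← Finset.sum_mul]
              ring
      · simp
  have hC : b [] * (1 - ρ)⁻¹ ≠ ⊤ :=
    ENNReal.mul_ne_top h0 (ENNReal.inv_ne_top.mpr (tsub_pos_of_lt hρ).ne')
  refine ne_top_of_le_ne_top hC ?_
  rw [ENNReal.tsum_eq_iSup_sum]
  refine iSup_le fun s => ?_
  calc ∑ ω ∈ s, b ω = ∑ ω ∈ s, (if ω.length < s.sup List.length + 1 then b ω else 0) := by
        refine Finset.sum_congr rfl fun ω hω => ?_
        rw [if_pos (Nat.lt_succ_of_le (Finset.le_sup (f := List.length) hω))]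
    _ ≤ _ := ENNReal.sum_le_tsum s
    _ ≤ _ := key _
    _ ≤ _ := by
        rw [← ENNReal.tsum_geometric]
        gcongr
        exact ENNReal.sum_le_tsum _

/-! ### Square summability of words at points of the row-ball. -/

/-- The square of the Frobenius norm. -/
noncomputable def frobSq {m n : Type*} [Fintype m] [Fintype n] (M : Matrix m n ℂ) : ℝ≥0∞ :=
  ∑ a, ∑ b, ‖M a b‖ₑ ^ 2

section Frobenius

variable {l m n : Type*} [Fintype l] [Fintype m] [Fintype n]

theorem entry_le_frobSq (M : Matrix m n ℂ) (a : m) (b : n) : ‖M a b‖ₑ ^ 2 ≤ frobSq M :=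
  (Finset.single_le_sum (f := fun b => ‖M a b‖ₑ ^ 2) (fun _ _ => zero_le)
    (Finset.mem_univ b)).trans
  (Finset.single_le_sum (f := fun a => ∑ b, ‖M a b‖ₑ ^ 2) (fun _ _ => zero_le)
    (Finset.mem_univ a))

theorem frobSq_ne_top (M : Matrix m n ℂ) : frobSq M ≠ ⊤ := by
  simp [frobSq, ENNReal.sum_eq_top]

theorem frobSq_conjTranspose (M : Matrix m n ℂ) : frobSq M.conjTranspose = frobSq M := by
  rw [frobSq, Finset.sum_comm]
  refine Finset.sum_congr rfl fun a _ => Finset.sum_congr rfl fun b _ => ?_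
  rw [Matrix.conjTranspose_apply, ← ofReal_norm, norm_star, ofReal_norm]

theorem frobSq_mul_le (M : Matrix l m ℂ) (N : Matrix m n ℂ) :
    frobSq (M * N) ≤ frobSq M * frobSq N := by
  calc frobSq (M * N) ≤ ∑ a, ∑ b, (∑ c, ‖M a c‖ₑ ^ 2) * ∑ c, ‖N c b‖ₑ ^ 2 := by
        refine Finset.sum_le_sum fun a _ => Finset.sum_le_sum fun b _ => ?_
        refine le_trans ?_ (sq_sum_mul_le _ _ _)
        gcongr
        rw [Matrix.mul_apply]
        refine (enorm_sum_le _ _).trans (le_of_eq ?_)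
        simp only [enorm_mul]
    _ = _ := by
        simp only [← Finset.mul_sum, ← Finset.sum_mul]
        rw [frobSq, frobSq]
        congr 1
        exact Finset.sum_comm

theorem trace_mul_conjTranspose (M : Matrix m n ℂ) :
    (M * M.conjTranspose).trace = ((frobSq M).toReal : ℂ) := by
  rw [frobSq, ENNReal.toReal_sum (by simp [ENNReal.sum_eq_top])]
  simp only [Matrix.trace, Matrix.diag_apply, Matrix.mul_apply, Matrix.conjTranspose_apply]
  push_cast
  refine Finset.sum_congr rfl fun a _ => ?_
  rw [ENNReal.toReal_sum (by simp)]
  push_cast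
  refine Finset.sum_congr rfl fun b _ => ?_
  have : star (M a b) = (starRingEnd ℂ) (M a b) := rfl
  rw [this, Complex.mul_conj']
  simp

end Frobenius

open scoped MatrixOrder Matrix.Norms.L2Operator in
theorem exists_factor_of_posDef {n : Type*} [Fintype n] [DecidableEq n] {M : Matrix n n ℂ}
    (hM : M.PosDef) : ∃ y : Matrix n n ℂ, IsUnit y ∧ M = y.conjTranspose * y := by
  obtain ⟨y, hy, h⟩ := CStarAlgebra.isStrictlyPositive_iff_eq_star_mul_self.mp
    hM.isStrictlyPositive
  exact ⟨y, hy, h⟩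

theorem wordProd_append {n : ℕ} (Z : Tuple ι n) (α β : List ι) :
    wordProd Z (α ++ β) = wordProd Z α * wordProd Z β := by
  simp [wordProd]

theorem wordProd_nil {n : ℕ} (Z : Tuple ι n) : wordProd Z [] = 1 := by
  simp [wordProd]

theorem wordProd_concat {n : ℕ} (Z : Tuple ι n) (α : List ι) (j : ι) :
    wordProd Z (α ++ [j]) = wordProd Z α * Z j := by
  simp [wordProd]

/-- With `1 - S = y^* y`, taking traces gives `∑ ‖V Z_j‖² + ‖V y^*‖² = ‖V‖²`. As `y` is invertible,
the second term is a fixed fraction of `‖V‖²`, so appending a letter shrinks the total by a factor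
below `1`. -/
theorem tsum_frobSq_wordProd_ne_top {n : ℕ} {Z : Tuple ι n} (hZ : Z ∈ rowBall ι n) :
    ∑' ω, frobSq (wordProd Z ω) ≠ ⊤ := by
  obtain ⟨S, hS, hpos⟩ := hZ
  obtain ⟨y, hy, hy'⟩ := exists_factor_of_posDef hpos
  obtain ⟨z, hz⟩ := hy.exists_left_inv
  have hyz : y.conjTranspose * z.conjTranspose = 1 := by
    rw [← Matrix.conjTranspose_mul, hz, Matrix.conjTranspose_one]
  -- The added `1` keeps `c` nonzero even for matrices of size `0`.
  set c : ℝ≥0∞ := frobSq z.conjTranspose + 1 with hc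
  have hc' : c ≠ ⊤ := by simp [hc, frobSq_ne_top]
  have hc0 : c ≠ 0 := by simp [hc]
  have hle : ∀ V : Matrix (Fin n) (Fin n) ℂ, frobSq V ≤ c * frobSq (V * y.conjTranspose) := by
    intro V
    calc frobSq V = frobSq (V * y.conjTranspose * z.conjTranspose) := by
          rw [mul_assoc, hyz, mul_one]
      _ ≤ _ := frobSq_mul_le _ _
      _ ≤ _ := by
          rw [mul_comm]
          gcongr
          exact le_self_add
  have hsum : ∀ V : Matrix (Fin n) (Fin n) ℂ,
      ∑' j, frobSq (V * Z j) + frobSq (V * y.conjTranspose) = frobSq V := by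
    intro V
    have h1 : HasSum (fun j => (V * (Z j * (Z j).conjTranspose) * V.conjTranspose).trace)
        (V * S * V.conjTranspose).trace :=
      ((hS.mul_left V).mul_right V.conjTranspose).map (Matrix.traceAddMonoidHom (Fin n) ℂ)
        (by simpa [Matrix.traceAddMonoidHom] using Continuous.matrix_trace continuous_id)
    have h2 : ∀ j, (V * (Z j * (Z j).conjTranspose) * V.conjTranspose).trace =
        ((frobSq (V * Z j)).toReal : ℂ) := by
      intro j
      rw [← trace_mul_conjTranspose, Matrix.conjTranspose_mul]
      simp only [mul_assoc]
    have h3 : (V * S * V.conjTranspose).trace =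
        (((frobSq V).toReal - (frobSq (V * y.conjTranspose)).toReal : ℝ) : ℂ) := by
      rw [Complex.ofReal_sub, ← trace_mul_conjTranspose, ← trace_mul_conjTranspose,
        Matrix.conjTranspose_mul, Matrix.conjTranspose_conjTranspose, ← Matrix.trace_sub]
      congr 1
      have : S = 1 - y.conjTranspose * y := by rw [← hy']; simp
      rw [this]
      noncomm_ring
    simp only [h2, h3] at h1
    have h4 : HasSum (fun j => (frobSq (V * Z j)).toReal)
        ((frobSq V).toReal - (frobSq (V * y.conjTranspose)).toReal) :=
      Complex.hasSum_ofReal.mp h1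
    have h5 : ∑' j, frobSq (V * Z j) =
        ENNReal.ofReal ((frobSq V).toReal - (frobSq (V * y.conjTranspose)).toReal) := by
      rw [← h4.tsum_eq, ENNReal.ofReal_tsum_of_nonneg (fun _ => ENNReal.toReal_nonneg) h4.summable]
      simp [ENNReal.ofReal_toReal, frobSq_ne_top]
    have h6 : 0 ≤ (frobSq V).toReal - (frobSq (V * y.conjTranspose)).toReal :=
      h4.nonneg fun _ => ENNReal.toReal_nonneg
    rw [h5]
    nth_rewrite 2 [← ENNReal.ofReal_toReal (frobSq_ne_top (V * y.conjTranspose))]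
    rw [← ENNReal.ofReal_add h6 ENNReal.toReal_nonneg,
      sub_add_cancel, ENNReal.ofReal_toReal (frobSq_ne_top _)]
  refine tsum_ne_top_of_geometric (ρ := 1 - c⁻¹)
    (ENNReal.sub_lt_self (by simp) (by simp) (by simpa using hc')) (frobSq_ne_top _) fun ω => ?_
  simp only [wordProd_concat]
  have h1 := hsum (wordProd Z ω)
  have h2 : c⁻¹ * frobSq (wordProd Z ω) ≤ frobSq (wordProd Z ω * y.conjTranspose) := by
    rw [mul_comm, ← div_eq_mul_inv]
    exact ENNReal.div_le_of_le_mul' (hle _)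
  rw [ENNReal.sub_mul (fun _ _ => frobSq_ne_top _), one_mul]
  refine ENNReal.le_sub_of_add_le_right
    (ENNReal.mul_ne_top (by simpa using hc0) (frobSq_ne_top _)) ?_
  calc _ ≤ _ := add_le_add_right h2 _
    _ = _ := h1

theorem tsum_entry_wordProd_ne_top {n : ℕ} {Z : Tuple ι n} (hZ : Z ∈ rowBall ι n)
    (a b : Fin n) : ∑' ω, ‖wordProd Z ω a b‖ₑ ^ 2 ≠ ⊤ :=
  ne_top_of_le_ne_top (tsum_frobSq_wordProd_ne_top hZ)
    (ENNReal.tsum_le_tsum fun _ => entry_le_frobSq _ a b)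

theorem summable_mul_of_sq {κ : Type*} {f g : κ → ℂ} (hf : ∑' i, ‖f i‖ₑ ^ 2 ≠ ⊤)
    (hg : ∑' i, ‖g i‖ₑ ^ 2 ≠ ⊤) : Summable fun i => f i * g i := by
  refine Summable.of_norm_bounded
    (((summable_sq_iff f).mpr hf).add ((summable_sq_iff g).mpr hg)) fun i => ?_
  rw [norm_mul]
  nlinarith [sq_nonneg (‖f i‖ - ‖g i‖), sq_nonneg (‖f i‖), sq_nonneg ‖g i‖]

theorem hasSum_matrix_iff {κ m n : Type*} {F : κ → Matrix m n ℂ} {M : Matrix m n ℂ} :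
    HasSum F M ↔ ∀ a b, HasSum (fun k => F k a b) (M a b) := by
  constructor
  · intro h a b
    exact Pi.hasSum.mp (Pi.hasSum.mp h a) b
  · intro h
    exact Pi.hasSum.mpr fun a => Pi.hasSum.mpr fun b => h a b

theorem exists_hasSum_matrix {κ m n : Type*} {F : κ → Matrix m n ℂ}
    (h : ∀ a b, Summable fun k => F k a b) : ∃ M, HasSum F M :=
  ⟨fun a b => ∑' k, F k a b, hasSum_matrix_iff.mpr fun a b => (h a b).hasSum⟩

theorem exists_hasValue {n : ℕ} {f : Series ι} (hf : tail 0 f ≠ ⊤) {Z : Tuple ι n}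
    (hZ : Z ∈ rowBall ι n) : ∃ M, HasValue f Z M := by
  rw [tail_zero] at hf
  exact exists_hasSum_matrix fun a b => summable_mul_of_sq hf (tsum_entry_wordProd_ne_top hZ a b)

/-! ### Poisson kernels and the Herglotz property. -/

/-- The completeness relation of the Poisson kernel of a point of the row-ball. -/
theorem hasSum_poisson {n : ℕ} {Z : Tuple ι n} (hZ : Z ∈ rowBall ι n)
    {S : Matrix (Fin n) (Fin n) ℂ} (hS : HasSum (fun j => Z j * (Z j).conjTranspose) S) :
    HasSum (fun α => wordProd Z α * (1 - S) * (wordProd Z α).conjTranspose) 1 := by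
  obtain ⟨N, hN⟩ := exists_hasSum_matrix
    (F := fun α => wordProd Z α * (wordProd Z α).conjTranspose) (fun a b => by
      simp only [Matrix.mul_apply, Matrix.conjTranspose_apply]
      refine summable_sum fun c _ => summable_mul_of_sq (tsum_entry_wordProd_ne_top hZ a c) ?_
      have := tsum_entry_wordProd_ne_top hZ b c
      convert this using 4 with ω
      rw [← ofReal_norm, norm_star, ofReal_norm])
  -- Telescoping: inserting `S` in the middle lengthens every word by one letter, so only the empty
  -- word survives in the difference.
  have h1 : HasSum (fun p : List ι × ι => wordProd Z (p.1 ++ [p.2]) *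
      (wordProd Z (p.1 ++ [p.2])).conjTranspose) (N - 1) := by
    refine (hasSum_concat_iff
      (F := fun α => wordProd Z α * (wordProd Z α).conjTranspose)).mpr ?_
    simpa [wordProd_nil] using hN
  have h2 : HasSum (fun α => wordProd Z α * S * (wordProd Z α).conjTranspose) (N - 1) := by
    refine h1.prod_fiberwise fun α => ?_
    have := (hS.mul_left (wordProd Z α)).mul_right (wordProd Z α).conjTranspose
    refine this.congr_fun ?_
    intro j
    simp only [wordProd_concat, Matrix.conjTranspose_mul, mul_assoc]
  have h3 := hN.sub h2
  have h4 : N - (N - 1) = 1 := sub_sub_cancel N 1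
  erw [h4] at h3
  refine h3.congr_fun ?_
  intro α
  noncomm_ring

theorem transpose_transpose (f : Series ι) : transpose (transpose f) = f := by
  funext ω
  simp [transpose]

/-- Reversal of words is unitary and turns right multiplication by `f^t` into left multiplication by
`f`. -/
theorem inner_atR_transpose {f : Series ι} (hf : f ∈ Hinf ι) {x : Series ι} (hx : Memℓp x 2)
    {t : ℂ} (ht : HasSum (fun p : List ι × List ι => star (x (p.1 ++ p.2)) * (f p.1 * x p.2)) t) :
    inner ℂ (⟨transpose x, memlp_transpose hx⟩ : Fock ι)
      (atR f hf ⟨transpose x, memlp_transpose hx⟩) = t := by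
  have h1 := hasSum_split (F := fun α β => star (x (α ++ β)) * (f α * x β)) ht
  refine (lp.hasSum_inner (𝕜 := ℂ) _ _).unique ?_
  have h4 := (Function.Involutive.toPerm List.reverse
    (List.reverse_involutive (α := ι))).hasSum_iff.mpr h1
  refine h4.congr_fun fun ω => ?_
  have h5 : atR f hf ⟨transpose x, memlp_transpose hx⟩ ω = conv f x ω.reverse := by
    rw [atR_apply, conv_transpose]
    change conv f (transpose (transpose x)) ω.reverse = _
    rw [transpose_transpose]
  rw [h5]
  change inner ℂ (x ω.reverse) _ = ∑ k ∈ Finset.range (ω.reverse.length + 1), _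
  simp only [List.take_append_drop, ← Finset.mul_sum]
  rw [RCLike.inner_apply, mul_comm]
  rfl

/-- The components of the Poisson kernel of `Z` at the vector `V`. -/
noncomputable def poissonVec {n : ℕ} (Z : Tuple ι n) (y : Matrix (Fin n) (Fin n) ℂ)
    (V : Matrix (Fin n) Unit ℂ) (i : Fin n) : Series ι :=
  fun α => (y * (wordProd Z α).conjTranspose * V) i ()

theorem tail_poissonVec_ne_top {n : ℕ} {Z : Tuple ι n} (hZ : Z ∈ rowBall ι n)
    (y : Matrix (Fin n) (Fin n) ℂ) (V : Matrix (Fin n) Unit ℂ) (i : Fin n) :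
    tail 0 (poissonVec Z y V i) ≠ ⊤ := by
  rw [tail_zero]
  have : ∀ α, ‖poissonVec Z y V i α‖ₑ ^ 2 ≤
      frobSq y * frobSq V * frobSq (wordProd Z α) := by
    intro α
    refine (entry_le_frobSq (y * (wordProd Z α).conjTranspose * V) i ()).trans
      ((frobSq_mul_le _ _).trans ?_)
    rw [mul_right_comm]
    gcongr
    refine (frobSq_mul_le _ _).trans ?_
    rw [frobSq_conjTranspose]
  refine ne_top_of_le_ne_top ?_ (ENNReal.tsum_le_tsum this)
  rw [ENNReal.tsum_mul_left]
  exact ENNReal.mul_ne_top (ENNReal.mul_ne_top (frobSq_ne_top _) (frobSq_ne_top _))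
    (tsum_frobSq_wordProd_ne_top hZ)

theorem hasSum_mul_mul {κ k l m n : Type*} [Fintype l] [Fintype m]
    {F : κ → Matrix l m ℂ} {M : Matrix l m ℂ} (h : HasSum F M) (A : Matrix k l ℂ)
    (B : Matrix m n ℂ) : HasSum (fun i => A * F i * B) (A * M * B) := by
  refine h.map (AddMonoidHom.mk' (fun C : Matrix l m ℂ => A * C * B) fun C D => ?_) ?_
  · rw [Matrix.mul_add, Matrix.add_mul]
  · change Continuous fun C : Matrix l m ℂ => A * C * B
    fun_prop

/-- For a fixed first word `ω`, the sum over the second word collapses by `hasSum_poisson`, leaving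
`f ω V^* Z^ω V`. The double sums `t i` are the quadratic form of left multiplication by `f` on the
kernel components. -/
theorem sum_poissonVec_eq {n : ℕ} {f : Series ι} {Z : Tuple ι n} (hZ : Z ∈ rowBall ι n)
    {S : Matrix (Fin n) (Fin n) ℂ} (hS : HasSum (fun j => Z j * (Z j).conjTranspose) S)
    {y : Matrix (Fin n) (Fin n) ℂ} (hy : 1 - S = y.conjTranspose * y)
    {M : Matrix (Fin n) (Fin n) ℂ} (hM : HasValue f Z M) (V : Matrix (Fin n) Unit ℂ)
    {t : Fin n → ℂ} (ht : ∀ i, HasSum (fun p : List ι × List ι =>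
      star (poissonVec Z y V i (p.1 ++ p.2)) * (f p.1 * poissonVec Z y V i p.2)) (t i)) :
    (V.conjTranspose * M * V) () () = ∑ i, t i := by
  have h1 : HasSum (fun p : List ι × List ι => ∑ i,
      star (poissonVec Z y V i (p.1 ++ p.2)) * (f p.1 * poissonVec Z y V i p.2)) (∑ i, t i) :=
    hasSum_sum fun i _ => ht i
  have h2 : ∀ ω α : List ι, ∑ i, star (poissonVec Z y V i (ω ++ α)) * (f ω * poissonVec Z y V i α) =
      f ω * (V.conjTranspose * wordProd Z ω * (wordProd Z α * (1 - S) *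
        (wordProd Z α).conjTranspose) * V : Matrix Unit Unit ℂ) () () := by
    intro ω α
    have h3 : V.conjTranspose * wordProd Z ω * (wordProd Z α * (1 - S) *
        (wordProd Z α).conjTranspose) * V =
        (y * (wordProd Z (ω ++ α)).conjTranspose * V).conjTranspose *
          (y * (wordProd Z α).conjTranspose * V) := by
      rw [hy, wordProd_append]
      simp only [Matrix.conjTranspose_mul, Matrix.conjTranspose_conjTranspose, Matrix.mul_assoc]
    rw [h3, Matrix.mul_apply, Finset.mul_sum]
    refine Finset.sum_congr rfl fun i _ => ?_
    rw [Matrix.conjTranspose_apply]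
    simp only [poissonVec]
    ring
  simp only [h2] at h1
  have h3 := h1.prod_fiberwise (g := fun ω => f ω * (V.conjTranspose * wordProd Z ω * V) () ())
    fun ω => by
      have h5 := hasSum_mul_mul (hasSum_poisson hZ hS) (V.conjTranspose * wordProd Z ω) V
      rw [Matrix.mul_one] at h5
      exact (hasSum_matrix_iff.mp h5 () ()).mul_left _
  refine HasSum.unique ?_ h3
  have h6 := hasSum_matrix_iff.mp (hasSum_mul_mul hM V.conjTranspose V) () ()
  refine h6.congr_fun fun ω => ?_
  simp

theorem isHerglotz_of_positive {s : ℝ≥0∞} (hs : 1 < s) (hs' : s ≠ ⊤) {f : Series ι}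
    (hf : weighted s f ≠ ⊤) (hfH : f ∈ Hinf ι)
    (hpos : ∀ h : Fock ι, 0 ≤ (inner ℂ h (atR f hfH h)).re) : IsHerglotz f := by
  intro n Z hZ
  obtain ⟨M, hM⟩ := exists_hasValue
    (ne_top_of_le_ne_top hf (tail_zero_le_weighted hs f)) hZ
  refine ⟨M, hM, ?_⟩
  obtain ⟨S, hS, hSpos⟩ := id hZ
  obtain ⟨y, -, hy⟩ := exists_factor_of_posDef hSpos
  refine Matrix.PosSemidef.of_dotProduct_mulVec_nonneg ?_ fun v => ?_
  · rw [Matrix.IsHermitian, Matrix.conjTranspose_smul, Matrix.conjTranspose_add,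
      Matrix.conjTranspose_conjTranspose, add_comm]
    simp
  let V : Matrix (Fin n) Unit ℂ := Matrix.of fun a _ => v a
  have hx := tail_poissonVec_ne_top hZ y V
  choose t ht using fun i => summable_pairing hs hs' hf (hx i) (hx i)
  have ht0 : ∀ i, 0 ≤ (t i).re := by
    intro i
    have hmem : Memℓp (poissonVec Z y V i) 2 := (memlp_iff _).mpr (by
      rw [← tail_zero]
      exact hx i)
    rw [← inner_atR_transpose hfH hmem (ht i)]
    exact hpos _
  have hform : star v ⬝ᵥ M.mulVec v = ∑ i, t i := by
    rw [← sum_poissonVec_eq hZ hS hy hM V ht, Matrix.mul_assoc, Matrix.mul_apply]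
    rfl
  have hform' : star v ⬝ᵥ M.conjTranspose.mulVec v = star (star v ⬝ᵥ M.mulVec v) := by
    rw [Matrix.star_dotProduct, Matrix.star_mulVec, ← Matrix.dotProduct_mulVec,
      Matrix.conjTranspose_conjTranspose]
  rw [Matrix.smul_mulVec, dotProduct_smul, Matrix.add_mulVec, dotProduct_add, hform', hform]
  have : (1 / 2 : ℂ) • (∑ i, t i + star (∑ i, t i)) = ((∑ i, (t i).re : ℝ) : ℂ) := by
    have h1 : star (∑ i, t i) = (starRingEnd ℂ) (∑ i, t i) := rfl
    rw [h1, Complex.add_conj, Complex.re_sum, smul_eq_mul]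
    push_cast
    ring
  rw [this]
  exact Complex.zero_le_real.mpr (Finset.sum_nonneg fun i _ => ht0 i)

end RowBall

end NCFock

namespace NCFock

/-! ### Rational expressions for realizations -/

section Elimination

variable {ι : Type*}

/-- Finite sums of rational expressions. -/
noncomputable def RatExpr.sum : {n : ℕ} → (Fin n → RatExpr ι) → RatExpr ι
  | 0, _ => .scalar 0
  | _ + 1, f => .add (f 0) (RatExpr.sum fun i => f i.succ)

theorem RatExpr.eval_sum {m : ℕ} (X : Tuple ι m) {n : ℕ} (f : Fin n → RatExpr ι) :
    (RatExpr.sum f).eval X = ∑ i, (f i).eval X := by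
  induction n with
  | zero => simp [RatExpr.sum, RatExpr.eval]
  | succ n ih => rw [Fin.sum_univ_succ, ← ih]; rfl

theorem RatExpr.inDom_sum {m : ℕ} (X : Tuple ι m) {n : ℕ} (f : Fin n → RatExpr ι) :
    (RatExpr.sum f).InDom X ↔ ∀ i, (f i).InDom X := by
  induction n with
  | zero => simp [RatExpr.sum, RatExpr.InDom]
  | succ n ih => rw [Fin.forall_fin_succ, ← ih]; rfl

/-- The linear form with coefficients `a` in the letters of `J`. -/
noncomputable def RatExpr.linear (J : Finset ι) (a : ι → ℂ) : RatExpr ι :=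
  RatExpr.sum fun k : Fin J.card =>
    .mul (.scalar (a (J.equivFin.symm k))) (.var (J.equivFin.symm k))

theorem RatExpr.eval_linear {m : ℕ} (X : Tuple ι m) (J : Finset ι) (a : ι → ℂ) :
    (RatExpr.linear J a).eval X = ∑ j ∈ J, a j • X j := by
  rw [RatExpr.linear, RatExpr.eval_sum, ← Finset.sum_coe_sort J,
    ← J.equivFin.symm.sum_comp (fun j : J => a j • X j)]
  exact Finset.sum_congr rfl fun k _ => by simp [RatExpr.eval]

theorem RatExpr.inDom_linear {m : ℕ} (X : Tuple ι m) (J : Finset ι) (a : ι → ℂ) :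
    (RatExpr.linear J a).InDom X :=
  (RatExpr.inDom_sum X _).mpr fun _ => ⟨trivial, trivial⟩

/-- Gaussian elimination: the solution of `G = c + G P` is given by rational expressions. -/
theorem RatExpr.exists_solution (n : ℕ) : ∀ (c : Fin n → RatExpr ι)
    (P : Fin n → Fin n → RatExpr ι), (∀ i, (c i).InDom (0 : Tuple ι 1)) →
    (∀ i l, (P i l).InDom (0 : Tuple ι 1) ∧ (P i l).eval (0 : Tuple ι 1) = 0) →
    ∃ e : Fin n → RatExpr ι, (∀ i, (e i).InDom (0 : Tuple ι 1)) ∧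
      ∀ (m : ℕ) (Z : Tuple ι m) (G : Fin n → Matrix (Fin m) (Fin m) ℂ),
        (∀ i, (e i).InDom Z) → (∀ i, G i = (c i).eval Z + ∑ l, G l * (P l i).eval Z) →
        ∀ i, G i = (e i).eval Z := by
  induction n with
  | zero =>
    intro c P _ _
    exact ⟨fun i => i.elim0, fun i => i.elim0, fun _ _ _ _ _ i => i.elim0⟩
  | succ n ih =>
    intro c P hc hP
    -- The pivot `1 - P 0 0` takes the value `1` at the origin because `P` vanishes there, and the
    -- reduced system inherits this property.
    let q : RatExpr ι := .add (.scalar 1) (.mul (.scalar (-1)) (P 0 0))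
    have hq : ∀ {m : ℕ} (X : Tuple ι m), q.eval X = 1 - (P 0 0).eval X := by
      intro m X
      simp [q, RatExpr.eval, sub_eq_add_neg]
    let u : RatExpr ι := .inv q
    have hu0 : u.InDom (0 : Tuple ι 1) := by
      refine ⟨⟨trivial, trivial, (hP 0 0).1⟩, ?_⟩
      rw [hq, (hP 0 0).2, sub_zero]
      exact isUnit_one
    let c' : Fin n → RatExpr ι := fun i =>
      .add (c i.succ) (.mul (.mul (c 0) u) (P 0 i.succ))
    let P' : Fin n → Fin n → RatExpr ι := fun l i =>
      .add (P l.succ i.succ) (.mul (.mul (P l.succ 0) u) (P 0 i.succ))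
    obtain ⟨e, he0, he⟩ := ih c' P'
      (fun i => ⟨hc _, ⟨hc _, hu0⟩, (hP _ _).1⟩)
      (fun l i => ⟨⟨(hP _ _).1, ⟨(hP _ _).1, hu0⟩, (hP _ _).1⟩, by
        simp [P', RatExpr.eval, (hP _ _).2]⟩)
    let e₀ : RatExpr ι := .mul
      (.add (c 0) (RatExpr.sum fun l => .mul (e l) (P l.succ 0))) u
    refine ⟨Fin.cons e₀ e, ?_, ?_⟩
    · refine Fin.cases ?_ he0
      exact ⟨⟨hc 0, (RatExpr.inDom_sum _ _).mpr fun l => ⟨he0 l, (hP _ _).1⟩⟩, hu0⟩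
    · intro m Z G hdom hG
      have hdom0 : e₀.InDom Z := hdom 0
      have hdom' : ∀ i, (e i).InDom Z := fun i => hdom i.succ
      have hunit : IsUnit (1 - (P 0 0).eval Z) := by
        rw [← hq]
        exact hdom0.2.2
      have hu : u.eval Z = (1 - (P 0 0).eval Z)⁻¹ := by
        rw [← hq]
        rfl
      have hinv : (1 - (P 0 0).eval Z) * u.eval Z = 1 := by
        rw [hu]
        exact Matrix.mul_nonsing_inv _ ((Matrix.isUnit_iff_isUnit_det _).mp hunit)
      have hG0 : G 0 = ((c 0).eval Z + ∑ l : Fin n, G l.succ * (P l.succ 0).eval Z) *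
          u.eval Z := by
        have h0 := hG 0
        rw [Fin.sum_univ_succ] at h0
        have h1 : G 0 * (1 - (P 0 0).eval Z) =
            (c 0).eval Z + ∑ l : Fin n, G l.succ * (P l.succ 0).eval Z := by
          rw [mul_sub, mul_one, sub_eq_iff_eq_add]
          nth_rewrite 1 [h0]
          abel
        rw [← h1, mul_assoc, hinv, mul_one]
      have hsucc : ∀ i : Fin n, G i.succ = (e i).eval Z := by
        refine he m Z (fun i => G i.succ) hdom' fun i => ?_
        rw [hG i.succ, Fin.sum_univ_succ, hG0]
        simp only [c', P', RatExpr.eval, mul_add, add_mul, Finset.sum_add_distrib,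
          Finset.sum_mul, mul_assoc]
        abel
      refine Fin.cases ?_ hsucc
      change G 0 = ((c 0).eval Z + (RatExpr.sum fun l => RatExpr.mul (e l) (P l.succ 0)).eval Z) *
        u.eval Z
      rw [hG0, RatExpr.eval_sum]
      simp only [RatExpr.eval, hsucc]

theorem hasSum_eq_sum {κ M : Type*} [AddCommMonoid M] [TopologicalSpace M] [T2Space M]
    {f : κ → M} {s : M} (h : HasSum f s) {J : Finset κ} (hJ : ∀ j ∉ J, f j = 0) :
    s = ∑ j ∈ J, f j :=
  h.unique (hasSum_sum_of_ne_finset_zero hJ)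

/-- A series with a realization in which only finitely many letters occur is NC rational. -/
theorem FMData.Realizes.isNCRational {n : ℕ} {F : FMData ι n} {f : Series ι}
    (hF : F.Realizes f) (J : Finset ι) (hA : ∀ j ∉ J, F.A j = 0) (hB : ∀ j ∉ J, F.B j = 0) :
    IsNCRational f := by
  obtain ⟨e, he0, he⟩ := RatExpr.exists_solution n (fun i => RatExpr.scalar (F.C () i) (ι := ι))
    (fun i l => RatExpr.linear J fun j => F.A j i l) (fun _ => trivial)
    (fun i l => ⟨RatExpr.inDom_linear _ _ _, by rw [RatExpr.eval_linear]; simp⟩)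
  refine ⟨.add (.scalar F.D)
    (RatExpr.sum fun i => .mul (e i) (RatExpr.linear J fun j => F.B j i ())), ?_, ?_⟩
  · exact ⟨trivial, (RatExpr.inDom_sum _ _).mpr fun i => ⟨he0 i, RatExpr.inDom_linear _ _ _⟩⟩
  · intro m Z hZ hdom
    have hdom' : ∀ i, (e i).InDom Z := fun i => ((RatExpr.inDom_sum _ _).mp hdom.2 i).1
    obtain ⟨P, Q, hP, hQ, hunit, hval⟩ := hF m Z hZ
    have hP' := hasSum_eq_sum hP (J := J) fun j hj => by rw [hA j hj, Matrix.zero_kronecker]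
    have hQ' := hasSum_eq_sum hQ (J := J) fun j hj => by rw [hB j hj, Matrix.zero_kronecker]
    -- The blocks of this row solve the linear system `K = C ⊗ 1 + K P`, to which elimination
    -- applies.
    set K := (F.C ⊗ₖ (1 : Matrix (Fin m) (Fin m) ℂ)) * (1 - P)⁻¹ with hK
    have hKP : K = F.C ⊗ₖ (1 : Matrix (Fin m) (Fin m) ℂ) + K * P := by
      have : K * (1 - P) = F.C ⊗ₖ (1 : Matrix (Fin m) (Fin m) ℂ) := by
        rw [hK, Matrix.mul_assoc,
          Matrix.nonsing_inv_mul _ ((Matrix.isUnit_iff_isUnit_det _).mp hunit), Matrix.mul_one]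
      rw [← this, Matrix.mul_sub, Matrix.mul_one, sub_add_cancel]
    let G : Fin n → Matrix (Fin m) (Fin m) ℂ := fun l => Matrix.of fun a b => K ((), a) (l, b)
    have hG := he m Z G hdom' (fun l => by
      ext a b
      refine (congrFun (congrFun hKP ((), a)) (l, b)).trans ?_
      rw [Matrix.add_apply, Matrix.add_apply, Matrix.mul_apply, Fintype.sum_prod_type,
        Matrix.sum_apply]
      refine congrArg₂ (· + ·) ?_ ?_
      · simp [RatExpr.eval, Matrix.one_apply]
      · refine Finset.sum_congr rfl fun i _ => ?_
        rw [Matrix.mul_apply]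
        refine Finset.sum_congr rfl fun k _ => ?_
        rw [RatExpr.eval_linear, hP', Matrix.sum_apply, Matrix.sum_apply]
        rfl)
    convert hval using 1
    change F.D • (1 : Matrix (Fin m) (Fin m) ℂ) + (RatExpr.sum fun i => _).eval Z = _
    congr 1
    rw [RatExpr.eval_sum]
    ext a b
    rw [Matrix.submatrix_apply, Matrix.mul_apply, Fintype.sum_prod_type, Matrix.sum_apply]
    refine Finset.sum_congr rfl fun i _ => ?_
    change ((e i).eval Z * (RatExpr.linear J fun j => F.B j i ()).eval Z) a b = _
    rw [← hG i, Matrix.mul_apply]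
    refine Finset.sum_congr rfl fun k _ => ?_
    rw [RatExpr.eval_linear, hQ', Matrix.sum_apply, Matrix.sum_apply]
    rfl

end Elimination

/-! ### Realizations and coefficients -/

section Realizations

open ENNReal

variable {ι : Type*}

/-- A system whose words are square summable realizes the series of its Markov parameters. -/
theorem FMData.realizes_of_summable {n : ℕ} (F : FMData ι n) (J : Finset ι)
    (hA : ∀ j ∉ J, F.A j = 0) (hB : ∀ j ∉ J, F.B j = 0)
    (hsum : ∀ i l, ∑' α, ‖wordProd F.A α i l‖ₑ ^ 2 ≠ ⊤) {f : Series ι} (hf : tail 0 f ≠ ⊤)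
    (h0 : f [] = F.D) (h1 : ∀ α j, f (α ++ [j]) = (F.C * wordProd F.A α * F.B j) () ()) :
    F.Realizes f := by
  intro m X hX
  have hP : HasSum (fun j => F.A j ⊗ₖ X j) (∑ j ∈ J, F.A j ⊗ₖ X j) :=
    hasSum_sum_of_ne_finset_zero fun j hj => by rw [hA j hj, Matrix.zero_kronecker]
  have hQ : HasSum (fun j => F.B j ⊗ₖ X j) (∑ j ∈ J, F.B j ⊗ₖ X j) :=
    hasSum_sum_of_ne_finset_zero fun j hj => by rw [hB j hj, Matrix.zero_kronecker]
  set P := ∑ j ∈ J, F.A j ⊗ₖ X j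
  set Q := ∑ j ∈ J, F.B j ⊗ₖ X j
  obtain ⟨N, hN⟩ := exists_hasSum_matrix (F := fun α => wordProd F.A α ⊗ₖ wordProd X α)
    fun a b => summable_mul_of_sq (hsum a.1 b.1) (tsum_entry_wordProd_ne_top hX a.2 b.2)
  -- `N` is the Neumann series of `P`, summed over words instead of powers; splitting off the last
  -- letter gives `N P = N - 1`.
  have hNP : N * (1 - P) = 1 := by
    have h2 : HasSum (fun p : List ι × ι => wordProd F.A (p.1 ++ [p.2]) ⊗ₖ
        wordProd X (p.1 ++ [p.2])) (N - 1) := by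
      refine (hasSum_concat_iff (F := fun α => wordProd F.A α ⊗ₖ wordProd X α)).mpr ?_
      simpa [wordProd_nil] using hN
    have h3 : HasSum (fun j => N * (F.A j ⊗ₖ X j)) (N - 1) := by
      refine ((Equiv.prodComm ι (List ι)).hasSum_iff.mpr h2).prod_fiberwise fun j => ?_
      refine (hN.mul_right (F.A j ⊗ₖ X j)).congr_fun fun α => ?_
      change wordProd F.A (α ++ [j]) ⊗ₖ wordProd X (α ++ [j]) = _
      rw [wordProd_concat, wordProd_concat, Matrix.mul_kronecker_mul]
    rw [mul_sub, mul_one, (hP.mul_left N).unique h3]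
    abel
  have hNinv : (1 - P)⁻¹ = N := Matrix.inv_eq_left_inv hNP
  refine ⟨P, Q, hP, hQ, IsUnit.of_mul_eq_one_right _ hNP, ?_⟩
  obtain ⟨M, hM⟩ := exists_hasValue hf hX
  have h2 : HasSum (fun p : List ι × ι => f (p.1 ++ [p.2]) • wordProd X (p.1 ++ [p.2]))
      (M - F.D • (1 : Matrix (Fin m) (Fin m) ℂ)) := by
    refine (hasSum_concat_iff (F := fun α => f α • wordProd X α)).mpr ?_
    rw [wordProd_nil, h0, add_sub_cancel]
    exact hM
  have h3 : HasSum (fun j => ((F.C ⊗ₖ (1 : Matrix (Fin m) (Fin m) ℂ)) * N *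
      (F.B j ⊗ₖ X j)).submatrix (fun i => ((), i)) (fun i => ((), i)))
      (M - F.D • (1 : Matrix (Fin m) (Fin m) ℂ)) := by
    refine ((Equiv.prodComm ι (List ι)).hasSum_iff.mpr h2).prod_fiberwise fun j => ?_
    have h4 := hasSum_mul_mul hN (F.C ⊗ₖ (1 : Matrix (Fin m) (Fin m) ℂ)) (F.B j ⊗ₖ X j)
    refine hasSum_matrix_iff.mpr fun a b => ?_
    refine (hasSum_matrix_iff.mp h4 ((), a) ((), b)).congr_fun fun α => ?_
    change (f (α ++ [j]) • wordProd X (α ++ [j])) a b = _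
    rw [← Matrix.mul_kronecker_mul, ← Matrix.mul_kronecker_mul, Matrix.kronecker_apply, h1,
      wordProd_concat, Matrix.one_mul]
    rfl
  have h5 : HasSum (fun j => ((F.C ⊗ₖ (1 : Matrix (Fin m) (Fin m) ℂ)) * N *
      (F.B j ⊗ₖ X j)).submatrix (fun i => ((), i)) (fun i => ((), i)))
      (((F.C ⊗ₖ (1 : Matrix (Fin m) (Fin m) ℂ)) * N * Q).submatrix
        (fun i => ((), i)) (fun i => ((), i))) := by
    have h6 := hasSum_mul_mul hQ ((F.C ⊗ₖ (1 : Matrix (Fin m) (Fin m) ℂ)) * N)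
      (1 : Matrix (Unit × Fin m) (Unit × Fin m) ℂ)
    simp only [Matrix.mul_one] at h6
    exact hasSum_matrix_iff.mpr fun a b => hasSum_matrix_iff.mp h6 ((), a) ((), b)
  rw [hNinv, h5.unique h3, add_sub_cancel]
  exact hM

/-! ### Coefficients of an arbitrary realization. -/

/-- The linear form with coefficients `φ`. -/
def letterSeries (φ : ι → ℂ) : Series ι
  | [j] => φ j
  | _ => 0

theorem shift_letterSeries (φ : ι → ℂ) (j : ι) :
    shift [j] (letterSeries φ) = φ j • mono [] := by
  funext α
  match α with
  | [] => simp [letterSeries, mono]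
  | [i] => simp [letterSeries, mono]
  | i :: k :: β => simp [letterSeries, mono]

theorem conv_letterSeries_nil (g : Series ι) (φ : ι → ℂ) : conv g (letterSeries φ) [] = 0 := by
  rw [conv_nil]
  simp [letterSeries]

theorem conv_letterSeries_concat (g : Series ι) (φ : ι → ℂ) (α : List ι) (j : ι) :
    conv g (letterSeries φ) (α ++ [j]) = g α * φ j := by
  rw [conv_concat, shift_letterSeries, conv_smul_right, conv_mono_nil]
  simp [letterSeries, mul_comm]

theorem hasSum_wordPoint (w : List ι) (φ : ι → ℂ) (a b : Fin (w.length + 1)) :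
    HasSum (fun j => φ j * wordPoint w j a b) (wordMat w (letterSeries φ) a b) := by
  simp only [wordPoint, wordMat_apply]
  split_ifs with hab
  · generalize (w.drop a).take ((b : ℕ) - a) = v
    match v with
    | [] => simp [letterSeries, mono]
    | [j] =>
      have := hasSum_single (f := fun k => φ k * ((1 / 2 : ℂ) ^ ((b : ℕ) - a) * mono [k] [j])) j
        fun k hk => by simp [mono, hk.symm]
      convert this using 1
      simp [letterSeries, mono, mul_comm]
    | i :: k :: β => simp [letterSeries, mono]
  · simp

/-- The coefficients of a series with a realization are its Markov parameters. -/
theorem FMData.Realizes.coeff_concat {n : ℕ} {F : FMData ι n} {f : Series ι}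
    (hF : F.Realizes f) (ω : List ι) (j : ι) :
    f (ω ++ [j]) = (F.C * wordProd F.A ω * F.B j) () () := by
  set w := ω ++ [j] with hw
  obtain ⟨P, Q, hP, hQ, hunit, hval⟩ := hF _ _ (wordPoint_mem_rowBall w)
  -- The series of `C A^α` solves `g = C + g A` formally. Its image under `wordMat` must therefore
  -- equal `(C ⊗ 1)(1 - P)⁻¹` at the word point.
  let g : Fin n → Series ι := fun l α => (F.C * wordProd F.A α) () l
  have hPe : ∀ i a l b, P (i, a) (l, b) = wordMat w (letterSeries fun j => F.A j i l) a b :=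
    fun i a l b => (hasSum_matrix_iff.mp hP (i, a) (l, b)).unique (hasSum_wordPoint w _ a b)
  have hQe : ∀ i a b, Q (i, a) ((), b) = wordMat w (letterSeries fun j => F.B j i ()) a b :=
    fun i a b => (hasSum_matrix_iff.mp hQ (i, a) ((), b)).unique (hasSum_wordPoint w _ a b)
  have hg : ∀ l, g l = F.C () l • mono [] + ∑ i, conv (g i) (letterSeries fun j => F.A j i l) := by
    intro l
    funext α
    rw [Pi.add_apply, Finset.sum_apply]
    induction α using List.reverseRecOn with
    | nil => simp [conv_letterSeries_nil, g, wordProd_nil, mono]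
    | append_singleton α k _ =>
      simp only [conv_letterSeries_concat]
      simp only [g, wordProd_concat, ← Matrix.mul_assoc]
      rw [Matrix.mul_apply]
      simp [mono]
  let K : Matrix (Unit × Fin (w.length + 1)) (Fin n × Fin (w.length + 1)) ℂ :=
    Matrix.of fun p q => wordMat w (g q.1) p.2 q.2
  have hK : K * (1 - P) = F.C ⊗ₖ (1 : Matrix (Fin (w.length + 1)) (Fin (w.length + 1)) ℂ) := by
    rw [Matrix.mul_sub, Matrix.mul_one, sub_eq_iff_eq_add]
    ext ⟨_, a⟩ ⟨l, b⟩
    rw [Matrix.add_apply, Matrix.mul_apply, Fintype.sum_prod_type]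
    change wordMat w (g l) a b = _
    rw [hg l, wordMat_add, wordMat_smul, wordMat_one, wordMat_sum, Matrix.add_apply,
      Matrix.sum_apply]
    congr 1
    refine Finset.sum_congr rfl fun i _ => ?_
    rw [wordMat_conv, Matrix.mul_apply]
    refine Finset.sum_congr rfl fun c _ => ?_
    rw [hPe]
    rfl
  have hK' : (F.C ⊗ₖ (1 : Matrix (Fin (w.length + 1)) (Fin (w.length + 1)) ℂ)) * (1 - P)⁻¹ = K := by
    rw [← hK, Matrix.mul_assoc,
      Matrix.mul_nonsing_inv _ ((Matrix.isUnit_iff_isUnit_det _).mp hunit), Matrix.mul_one]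
  rw [hK'] at hval
  have h1 := value_wordPoint hval
  have hKQ : (K * Q) ((), 0) ((), Fin.last _) =
      (1 / 2 : ℂ) ^ w.length * ∑ i, g i ω * F.B j i () := by
    rw [Matrix.mul_apply, Fintype.sum_prod_type, Finset.mul_sum]
    refine Finset.sum_congr rfl fun i _ => ?_
    rw [← conv_letterSeries_concat (g i) (fun j => F.B j i ()), ← hw, ← wordMat_zero_last,
      wordMat_conv, Matrix.mul_apply]
    refine Finset.sum_congr rfl fun c _ => ?_
    rw [hQe]
    rfl
  -- Since `w` is nonempty, its corner entry is off the diagonal and the constant `D` drops out.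
  have hne : (0 : Fin (w.length + 1)) ≠ Fin.last _ := by
    intro h
    have := congrArg Fin.val h
    simp [hw] at this
  rw [Matrix.add_apply, Matrix.submatrix_apply, hKQ, Matrix.smul_apply,
    Matrix.one_apply_ne hne, smul_zero, zero_add] at h1
  rw [← mul_left_cancel₀ (by positivity) h1, Matrix.mul_apply]

end Realizations

end NCFock

namespace NCFock

/-! ### The canonical realization -/

section Canonical

open ENNReal

variable {ι : Type*}

/-- The coefficients of an element of the Fock space, as a linear map. -/
noncomputable def coeLin (ι : Type*) : Fock ι →ₗ[ℂ] Series ι where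
  toFun h := h
  map_add' _ _ := rfl
  map_smul' _ _ := rfl

theorem coeLin_injective : Function.Injective (coeLin ι) := fun _ _ h => Subtype.ext h

theorem Recognizable.exists_orbit {r : Fock ι} (hr : Recognizable (r : Series ι)) :
    FiniteDimensional ℂ (orbitSpan r) ∧
      ∃ J : Finset ι, ∀ j ∉ J, ∀ w ∈ orbitSpan r, fockShift [j] w = 0 := by
  obtain ⟨W, J, hW, hrW, hinv, hz⟩ := hr
  have hinv' : ∀ ν, ∀ w ∈ W, shift ν w ∈ W := by
    intro ν
    induction ν with
    | nil =>
      intro w hw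
      have : shift [] w = w := by funext α; simp
      rwa [this]
    | cons j ν ih =>
      intro w hw
      have := hinv j _ (ih w hw)
      rwa [shift_shift] at this
  have hle : orbitSpan r ≤ W.comap (coeLin ι) := by
    refine Submodule.span_le.mpr ?_
    rintro _ ⟨ν, rfl⟩
    exact hinv' ν _ hrW
  refine ⟨?_, J, fun j hj w hw => Subtype.ext (hz j hj _ (hle hw))⟩
  exact FiniteDimensional.of_injective ((coeLin ι).restrict hle)
    fun x y hxy => Subtype.ext (coeLin_injective (congrArg W.subtype hxy))

/-- The state space of the canonical realization. -/
noncomputable def stateSpan (r : Fock ι) : Submodule ℂ (Fock ι) :=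
  Submodule.span ℂ (Set.range fun p : List ι × ι => fockShift (p.1 ++ [p.2]) r)

theorem stateSpan_le (r : Fock ι) : stateSpan r ≤ orbitSpan r :=
  Submodule.span_mono (by rintro _ ⟨p, rfl⟩; exact ⟨_, rfl⟩)

theorem fockShift_concat_mem_stateSpan (r : Fock ι) (α : List ι) (j : ι) :
    fockShift (α ++ [j]) r ∈ stateSpan r :=
  Submodule.subset_span ⟨(α, j), rfl⟩

theorem fockShift_mem_stateSpan (r : Fock ι) (ν : List ι) :
    ∀ w ∈ stateSpan r, fockShift ν w ∈ stateSpan r := by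
  have : stateSpan r ≤ (stateSpan r).comap (fockShift ν) := by
    refine Submodule.span_le.mpr ?_
    rintro _ ⟨p, rfl⟩
    change fockShift ν (fockShift (p.1 ++ [p.2]) r) ∈ stateSpan r
    rw [fockShift_fockShift, ← List.append_assoc]
    exact fockShift_concat_mem_stateSpan r _ _
  exact this

/-- Translation on the state space. -/
noncomputable def stateShift (r : Fock ι) (ν : List ι) : stateSpan r →ₗ[ℂ] stateSpan r :=
  (fockShift ν).restrict (fockShift_mem_stateSpan r ν)

/-- The canonical realization with output functional `φ`. -/
noncomputable def canonicalFM (r : Fock ι) {n : ℕ} (b : Module.Basis (Fin n) ℂ (stateSpan r))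
    (φ : Fock ι →ₗ[ℂ] ℂ) (D : ℂ) : FMData ι n where
  A j := LinearMap.toMatrix b b (stateShift r [j])
  B j := Matrix.of fun i _ => b.repr ⟨fockShift ([] ++ [j]) r,
    fockShift_concat_mem_stateSpan r [] j⟩ i
  C := Matrix.of fun _ i => φ (b i)
  D := D

theorem wordProd_canonicalFM (r : Fock ι) {n : ℕ} (b : Module.Basis (Fin n) ℂ (stateSpan r))
    (φ : Fock ι →ₗ[ℂ] ℂ) (D : ℂ) (α : List ι) :
    wordProd (canonicalFM r b φ D).A α = LinearMap.toMatrix b b (stateShift r α) := by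
  induction α with
  | nil =>
    have : stateShift r [] = LinearMap.id := by
      ext1 w
      exact Subtype.ext (fockShift_nil _)
    rw [wordProd_nil, this, LinearMap.toMatrix_id]
  | cons j α ih =>
    have h1 : wordProd (canonicalFM r b φ D).A (j :: α) =
        (canonicalFM r b φ D).A j * wordProd (canonicalFM r b φ D).A α := by
      simp [wordProd]
    have h2 : stateShift r (j :: α) = stateShift r [j] ∘ₗ stateShift r α := by
      ext1 w
      exact Subtype.ext (fockShift_fockShift [j] α w).symm
    rw [h1, ih, h2, LinearMap.toMatrix_comp b b b]
    rfl

theorem canonicalFM_markov (r : Fock ι) {n : ℕ} (b : Module.Basis (Fin n) ℂ (stateSpan r))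
    (φ : Fock ι →ₗ[ℂ] ℂ) (D : ℂ) (α : List ι) (j : ι) :
    ((canonicalFM r b φ D).C * wordProd (canonicalFM r b φ D).A α *
      (canonicalFM r b φ D).B j) () () = φ (fockShift (α ++ [j]) r) := by
  set v : stateSpan r := ⟨fockShift ([] ++ [j]) r, fockShift_concat_mem_stateSpan r [] j⟩ with hv
  have h1 : ∀ i, (wordProd (canonicalFM r b φ D).A α * (canonicalFM r b φ D).B j) i () =
      b.repr (stateShift r α v) i := by
    intro i
    rw [wordProd_canonicalFM, ← LinearMap.toMatrix_mulVec_repr b b (stateShift r α) v]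
    rfl
  have h2 : (stateShift r α v : Fock ι) = fockShift (α ++ [j]) r := fockShift_fockShift _ _ r
  rw [Matrix.mul_assoc, Matrix.mul_apply, ← h2]
  have h3 := congrArg (φ ∘ₗ (stateSpan r).subtype) (b.sum_repr (stateShift r α v))
  rw [map_sum] at h3
  refine Eq.trans (Finset.sum_congr rfl fun i _ => ?_) h3
  rw [h1, map_smul, smul_eq_mul, mul_comm]
  rfl

/-- The state matrices are translations on a finite-dimensional space, so the decay of translates
makes their words square summable. The functional `φ` is free, which allows one system to realize
both `r` and `H`. -/
theorem canonicalFM_realizes (r : Fock ι) [FiniteDimensional ℂ (orbitSpan r)] {n : ℕ}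
    (b : Module.Basis (Fin n) ℂ (stateSpan r)) (φ : Fock ι →ₗ[ℂ] ℂ) {J : Finset ι}
    (hJ : ∀ j ∉ J, ∀ w ∈ orbitSpan r, fockShift [j] w = 0) {f : Series ι} (hf : tail 0 f ≠ ⊤)
    (hφ : ∀ α j, f (α ++ [j]) = φ (fockShift (α ++ [j]) r)) :
    (canonicalFM r b φ (f [])).Realizes f ∧ (∀ j ∉ J, (canonicalFM r b φ (f [])).A j = 0) ∧
      ∀ j ∉ J, (canonicalFM r b φ (f [])).B j = 0 := by
  have hA : ∀ j ∉ J, (canonicalFM r b φ (f [])).A j = 0 := by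
    intro j hj
    have : stateShift r [j] = 0 := by
      ext1 w
      exact Subtype.ext (hJ j hj _ (stateSpan_le r w.2))
    change LinearMap.toMatrix b b (stateShift r [j]) = 0
    rw [this, map_zero]
  have hr : r ∈ orbitSpan r := Submodule.subset_span ⟨[], fockShift_nil r⟩
  have hB : ∀ j ∉ J, (canonicalFM r b φ (f [])).B j = 0 := by
    intro j hj
    have : (⟨fockShift ([] ++ [j]) r, fockShift_concat_mem_stateSpan r [] j⟩ : stateSpan r) = 0 :=
      Subtype.ext (hJ j hj r hr)
    ext i k
    change b.repr ⟨fockShift ([] ++ [j]) r, fockShift_concat_mem_stateSpan r [] j⟩ i = 0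
    rw [this, map_zero]
    rfl
  refine ⟨FMData.realizes_of_summable _ J hA hB ?_ hf rfl fun α j => ?_, hA, hB⟩
  · intro i l
    obtain ⟨s, hs, hs', hw⟩ := exists_weighted_orbitSpan r
    obtain ⟨M, hM, hb⟩ := exists_coord_bound _ b
    have hfin := tsum_weighted_tail_shift_ne_top hs hs' (hw _ (stateSpan_le r (b l).2))
    refine ne_top_of_le_ne_top (ENNReal.mul_ne_top (ENNReal.pow_ne_top hM (n := 2)) hfin) ?_
    rw [← ENNReal.tsum_mul_left]
    refine ENNReal.tsum_le_tsum fun α => ?_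
    rw [wordProd_canonicalFM, LinearMap.toMatrix_apply]
    calc ‖b.repr (stateShift r α (b l)) i‖ₑ ^ 2
        ≤ (M * ‖(stateShift r α (b l) : Fock ι)‖ₑ) ^ 2 := by
          gcongr
          exact hb _ i
      _ = M ^ 2 * tail 0 (shift α (b l : Fock ι)) := by
          rw [mul_pow, enorm_sq_eq_tail]
          rfl
      _ ≤ _ := by
          gcongr
          exact le_mul_of_one_le_left zero_le (one_le_pow₀ (one_le_pow₀ hs.le))
  · rw [canonicalFM_markov, hφ]

/-- The canonical state space is no larger than that of any realization. -/
theorem finrank_stateSpan_le (r : Fock ι) {n : ℕ} {F : FMData ι n}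
    (hF : F.Realizes (r : Series ι)) : Module.finrank ℂ (stateSpan r) ≤ n := by
  -- The observability map; the translate of `r` by `ν j` is the image of the vector `A^ν B_j`.
  let O : (Fin n → ℂ) →ₗ[ℂ] Series ι :=
    { toFun := fun x α => ((F.C * wordProd F.A α).mulVec x) ()
      map_add' := fun x y => by
        funext α
        simp [Matrix.mulVec_add]
      map_smul' := fun c x => by
        funext α
        simp [Matrix.mulVec_smul] }
  have hle : (stateSpan r).map (coeLin ι) ≤ LinearMap.range O := by
    rw [stateSpan, Submodule.map_span, Submodule.span_le]
    rintro _ ⟨_, ⟨⟨ν, j⟩, rfl⟩, rfl⟩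
    refine ⟨fun i => (wordProd F.A ν * F.B j) i (), ?_⟩
    funext α
    change ((F.C * wordProd F.A α).mulVec fun i => (wordProd F.A ν * F.B j) i ()) () =
      r (α ++ (ν ++ [j]))
    have h : F.C * wordProd F.A (α ++ ν) * F.B j =
        F.C * wordProd F.A α * (wordProd F.A ν * F.B j) := by
      rw [wordProd_append]
      simp only [Matrix.mul_assoc]
    rw [← List.append_assoc, hF.coeff_concat, h]
    rfl
  calc Module.finrank ℂ (stateSpan r)
      = Module.finrank ℂ ((stateSpan r).map (coeLin ι)) :=
        (Submodule.equivMapOfInjective _ coeLin_injective _).finrank_eq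
    _ ≤ Module.finrank ℂ (LinearMap.range O) := Submodule.finrank_mono hle
    _ ≤ Module.finrank ℂ (Fin n → ℂ) := LinearMap.finrank_range_le O
    _ = n := by simp

/-! ### The Herglotz function -/

open Classical in
/-- The analytic half of the Toeplitz operator `r(R)^* r(R)`. -/
noncomputable def herglotzSeries (r : Fock ι) : Series ι :=
  fun ω => if ω = [] then inner ℂ r r else 2 * inner ℂ r (fockShift ω r)

theorem herglotzSeries_nil (r : Fock ι) : herglotzSeries r [] = inner ℂ r r := by
  simp [herglotzSeries]

theorem herglotzSeries_of_ne (r : Fock ι) {ω : List ι} (h : ω ≠ []) :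
    herglotzSeries r ω = 2 * inner ℂ r (fockShift ω r) := by
  simp [herglotzSeries, h]

theorem enorm_herglotzSeries_le (r : Fock ι) (ω : List ι) :
    ‖herglotzSeries r ω‖ₑ ≤ 2 * ‖r‖ₑ * ‖fockShift ω r‖ₑ := by
  have h : ‖herglotzSeries r ω‖ ≤ 2 * ‖r‖ * ‖fockShift ω r‖ := by
    by_cases hω : ω = []
    · subst hω
      rw [herglotzSeries_nil, fockShift_nil]
      refine (norm_inner_le_norm r r).trans ?_
      nlinarith [mul_nonneg (norm_nonneg r) (norm_nonneg r)]
    · rw [herglotzSeries_of_ne r hω, norm_mul, mul_assoc]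
      simp only [RCLike.norm_ofNat]
      gcongr
      exact norm_inner_le_norm _ _
  have h2 := ENNReal.ofReal_le_ofReal h
  rw [ENNReal.ofReal_mul (by positivity), ENNReal.ofReal_mul (by positivity), ofReal_norm,
    ofReal_norm, ofReal_norm] at h2
  simpa using h2

theorem weighted_herglotzSeries_ne_top {s : ℝ≥0∞} (hs : 1 < s) (hs' : s ≠ ⊤) {r : Fock ι}
    (hr : weighted s (r : Series ι) ≠ ⊤) : weighted s (herglotzSeries r) ≠ ⊤ := by
  have hfin := tsum_weighted_tail_shift_ne_top hs hs' hr
  refine ne_top_of_le_ne_top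
    (ENNReal.mul_ne_top (a := (2 * ‖r‖ₑ) ^ 2) (by simp [ENNReal.mul_eq_top]) hfin) ?_
  rw [weighted, ← ENNReal.tsum_mul_left]
  refine ENNReal.tsum_le_tsum fun ω => ?_
  calc (s ^ ω.length * ‖herglotzSeries r ω‖ₑ) ^ 2
      ≤ (s ^ ω.length * (2 * ‖r‖ₑ * ‖fockShift ω r‖ₑ)) ^ 2 := by
        gcongr
        exact enorm_herglotzSeries_le r ω
    _ = (2 * ‖r‖ₑ) ^ 2 * ((s ^ ω.length) ^ 2 * ‖fockShift ω r‖ₑ ^ 2) := by ring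
    _ = _ := by
        rw [enorm_sq_eq_tail]
        rfl

theorem memlp_of_mem_Hinf {r : Series ι} (hr : r ∈ Hinf ι) : Memℓp r 2 := by
  have h : Memℓp (mono ([] : List ι)) 2 := by
    rw [memlp_iff, tsum_eq_single []]
    · simp
    · intro ω hω
      simp [mono, hω]
  have h1 := hr ⟨mono [], h⟩
  change Memℓp (conv r (mono [])) 2 at h1
  rwa [conv_mono_nil] at h1

/-! ### The operator identity -/

theorem conv_mono_append (β γ : List ι) (g : Series ι) : conv (mono β) g (β ++ γ) = g γ := by
  rw [conv, Finset.sum_eq_single β.length]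
  · simp [mono]
  · intro k hk hne
    have : (β ++ γ).take k ≠ β := fun h' => hne (by
      have := congrArg List.length h'
      simp at this hk
      omega)
    simp [mono, this]
  · intro h
    simp at h

theorem conv_mono_eq_zero {β ω : List ι} (h : ¬ β <+: ω) (g : Series ι) :
    conv (mono β) g ω = 0 := by
  refine Finset.sum_eq_zero fun k _ => ?_
  have : ω.take k ≠ β := fun h' => h (h' ▸ List.take_prefix k ω)
  simp [mono, this]

open Classical in
/-- The orthonormal basis of monomials. -/
noncomputable def fockMono (α : List ι) : Fock ι := lp.single 2 α (1 : ℂ)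

theorem coe_fockMono (α : List ι) : ⇑(fockMono α) = mono α := by
  classical
  funext β
  rw [fockMono, lp.coeFn_single, mono]
  by_cases h : β = α
  · subst h; simp
  · simp [h]

theorem inner_fockMono_left (α : List ι) (h : Fock ι) : inner ℂ (fockMono α) h = h α := by
  classical
  rw [fockMono, lp.inner_single_left]
  simp

theorem atR_fockMono {f : Series ι} (hf : f ∈ Hinf ι) (α ω : List ι) :
    atR f hf (fockMono α) ω = conv (mono α) (transpose f) ω := by
  rw [atR_apply, coe_fockMono]

theorem ext_fockMono {T U : Fock ι →L[ℂ] Fock ι}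
    (h : ∀ α β, inner ℂ (fockMono α) (T (fockMono β)) = inner ℂ (fockMono α) (U (fockMono β))) :
    T = U := by
  classical
  refine lp.ext_continuousLinearMap (by norm_num) fun β => ?_
  ext1
  refine lp.ext (funext fun α => ?_)
  have := h α β
  rwa [inner_fockMono_left, inner_fockMono_left] at this

/-- Both vectors restrict to words `β γ δ`, where their coefficients are `r^t δ` and `r^t (γ δ)`;
reversing `δ` gives the translate. -/
theorem inner_atR_fockMono_append {r : Fock ι} (hr : (r : Series ι) ∈ Hinf ι) (β γ : List ι) :
    inner ℂ (atR r hr (fockMono (β ++ γ))) (atR r hr (fockMono β)) =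
      inner ℂ r (fockShift γ.reverse r) := by
  have h1 := lp.hasSum_inner (𝕜 := ℂ) (atR r hr (fockMono (β ++ γ))) (atR r hr (fockMono β))
  simp only [atR_fockMono] at h1
  have h2 := lp.hasSum_inner (𝕜 := ℂ) r (fockShift γ.reverse r)
  refine h1.unique ?_
  rw [← (List.append_right_injective (β ++ γ)).hasSum_iff]
  · have h3 := (Function.Involutive.toPerm List.reverse
      (List.reverse_involutive (α := ι))).hasSum_iff.mpr h2
    refine h3.congr_fun fun δ => ?_
    have h4 : conv (mono (β ++ γ)) (transpose r) (β ++ γ ++ δ) = r δ.reverse :=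
      conv_mono_append _ _ _
    have h5 : conv (mono β) (transpose r) (β ++ γ ++ δ) = r (δ.reverse ++ γ.reverse) := by
      rw [List.append_assoc, conv_mono_append, transpose, List.reverse_append]
    simp only [Function.comp_apply]
    rw [h4, h5]
    rfl
  · intro ω hω
    rw [conv_mono_eq_zero, inner_zero_left]
    rintro ⟨δ, rfl⟩
    exact hω ⟨δ, rfl⟩

theorem inner_atR_fockMono_eq_zero {r : Series ι} (hr : r ∈ Hinf ι) {α β : List ι}
    (h1 : ¬ α <+: β) (h2 : ¬ β <+: α) :
    inner ℂ (atR r hr (fockMono α)) (atR r hr (fockMono β)) = 0 := by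
  have h := lp.hasSum_inner (𝕜 := ℂ) (atR r hr (fockMono α)) (atR r hr (fockMono β))
  simp only [atR_fockMono] at h
  refine h.unique ?_
  convert hasSum_zero using 2 with ω
  by_cases h3 : α <+: ω
  · rw [conv_mono_eq_zero (β := β), inner_zero_right]
    intro h4
    rcases List.prefix_or_prefix_of_prefix h3 h4 with h5 | h5
    · exact h1 h5
    · exact h2 h5
  · rw [conv_mono_eq_zero h3, inner_zero_left]

theorem inner_reOp (T : Fock ι →L[ℂ] Fock ι) (h k : Fock ι) :
    inner ℂ h (reOp T k) = (1 / 2 : ℂ) * (inner ℂ h (T k) + inner ℂ (T h) k) := by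
  rw [reOp, smul_apply, add_apply, inner_smul_right,
    inner_add_right, ContinuousLinearMap.adjoint_inner_right]

/-- For `γ ≠ []` only `H(R)` contributes, and its factor `2` cancels the `1/2`. On the diagonal both
`H(R)` and its adjoint contribute, which is why the constant term carries no `2`. -/
theorem inner_reOp_append {r : Fock ι} (hH : herglotzSeries r ∈ Hinf ι) (β γ : List ι) :
    inner ℂ (fockMono (β ++ γ)) (reOp (atR (herglotzSeries r) hH) (fockMono β)) =
      inner ℂ r (fockShift γ.reverse r) := by
  rw [inner_reOp, ← inner_conj_symm (atR _ hH (fockMono (β ++ γ))), inner_fockMono_left,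
    inner_fockMono_left, atR_fockMono, atR_fockMono, conv_mono_append, transpose]
  by_cases hγ : γ = []
  · subst hγ
    have h1 : conv (mono (β ++ [])) (transpose (herglotzSeries r)) β = inner ℂ r r := by
      have := conv_mono_append β [] (transpose (herglotzSeries r))
      rw [List.append_nil] at this ⊢
      rw [this]
      exact herglotzSeries_nil r
    rw [h1, inner_conj_symm, List.reverse_nil, herglotzSeries_nil, fockShift_nil]
    ring
  · have h1 : ¬ (β ++ γ) <+: β := by
      intro h
      have := h.length_le
      simp at this
      exact hγ this
    rw [conv_mono_eq_zero h1, herglotzSeries_of_ne r (by simpa using hγ), map_zero]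
    ring

/-- Entries are compared on monomials: one prefix order is computed directly, the other follows by
conjugation, and incomparable words give `0` on both sides. -/
theorem adjoint_comp_atR_eq {r : Fock ι} (hr : (r : Series ι) ∈ Hinf ι)
    (hH : herglotzSeries r ∈ Hinf ι) :
    ContinuousLinearMap.adjoint (atR r hr) ∘L atR r hr =
      reOp (atR (herglotzSeries r) hH) := by
  refine ext_fockMono fun α β => ?_
  rw [ContinuousLinearMap.comp_apply, ContinuousLinearMap.adjoint_inner_right]
  by_cases h1 : β <+: α
  · obtain ⟨γ, rfl⟩ := h1
    rw [inner_atR_fockMono_append, inner_reOp_append]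
  by_cases h2 : α <+: β
  · obtain ⟨γ, rfl⟩ := h2
    have h3 := inner_reOp_append hH α γ
    have h4 : inner ℂ (fockMono α) (reOp (atR (herglotzSeries r) hH) (fockMono (α ++ γ))) =
        (starRingEnd ℂ) (inner ℂ (fockMono (α ++ γ))
          (reOp (atR (herglotzSeries r) hH) (fockMono α))) := by
      rw [inner_reOp, inner_reOp, map_mul, map_add, inner_conj_symm, inner_conj_symm, add_comm,
        map_div₀, map_one, map_ofNat]
    rw [h4, h3, ← inner_conj_symm, inner_atR_fockMono_append]
  · rw [inner_atR_fockMono_eq_zero hr h2 h1, inner_reOp,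
      ← inner_conj_symm (atR _ hH (fockMono α)), inner_fockMono_left, inner_fockMono_left,
      atR_fockMono, atR_fockMono, conv_mono_eq_zero h1, conv_mono_eq_zero h2]
    simp

theorem re_inner_reOp (T : Fock ι →L[ℂ] Fock ι) (h : Fock ι) :
    (inner ℂ h (reOp T h)).re = (inner ℂ h (T h)).re := by
  rw [inner_reOp, ← inner_conj_symm (T h), Complex.add_conj]
  simp

end Canonical

end NCFock

theorem mainTheorem12 {ι : Type*} [Countable ι] (r : NCFock.Series ι) (hr : r ∈ NCFock.Hinf ι)
    (hrat : NCFock.IsNCRational r) :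
    ∃ (H : NCFock.Series ι) (hH : H ∈ NCFock.Hinf ι),
      NCFock.IsNCRational H ∧ NCFock.IsHerglotz H ∧
      ContinuousLinearMap.adjoint (NCFock.atR r hr) ∘L NCFock.atR r hr =
        NCFock.reOp (NCFock.atR H hH) ∧
      (NCFock.reOp (NCFock.atR H hH)).IsPositive ∧
      NCFock.fmDim r < ⊤ ∧ NCFock.fmDim H ≤ NCFock.fmDim r + 1 := by
  open NCFock in
  obtain ⟨R, rfl⟩ : ∃ R : Fock ι, (R : Series ι) = r := ⟨⟨r, memlp_of_mem_Hinf hr⟩, rfl⟩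
  obtain ⟨hfin, J, hJ⟩ := hrat.recognizable.exists_orbit
  obtain ⟨s, hs, hs', hw⟩ := exists_weighted_orbitSpan R
  have hwH := weighted_herglotzSeries_ne_top hs hs'
    (hw R (Submodule.subset_span ⟨[], fockShift_nil R⟩))
  have hH := mem_Hinf_of_weighted hs hs' hwH
  have hop := adjoint_comp_atR_eq hr hH
  have hpos : (reOp (atR (herglotzSeries R) hH)).IsPositive := by
    rw [← hop]
    exact ContinuousLinearMap.isPositive_adjoint_comp_self _
  have : FiniteDimensional ℂ (stateSpan R) := Submodule.finiteDimensional_of_le (stateSpan_le R)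
  let b := Module.finBasis ℂ (stateSpan R)
  -- The same basis serves both series: evaluation at the empty word outputs `r`, and `2⟨R, ·⟩`
  -- outputs `H`.
  obtain ⟨hFr, -, -⟩ := canonicalFM_realizes R b (LinearMap.proj [] ∘ₗ coeLin ι) hJ
    (f := R) (tail_zero_ne_top R) (fun α j => rfl)
  obtain ⟨hFH, hA, hB⟩ := canonicalFM_realizes R b ((2 : ℂ) • (innerSL ℂ R).toLinearMap) hJ
    (ne_top_of_le_ne_top hwH (tail_zero_le_weighted hs _))
    (fun α j => herglotzSeries_of_ne R (by simp))
  have h1 : fmDim (R : Series ι) ≤ (Module.finrank ℂ (stateSpan R) : ℕ∞) :=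
    iInf₂_le _ ⟨_, hFr⟩
  have h2 : fmDim (herglotzSeries R) ≤ (Module.finrank ℂ (stateSpan R) : ℕ∞) :=
    iInf₂_le _ ⟨_, hFH⟩
  have h3 : (Module.finrank ℂ (stateSpan R) : ℕ∞) ≤ fmDim (R : Series ι) :=
    le_iInf₂ fun n ⟨F, hF⟩ => by exact_mod_cast finrank_stateSpan_le R hF
  refine ⟨herglotzSeries R, hH, hFH.isNCRational J hA hB,
    isHerglotz_of_positive hs hs' hwH hH fun h => ?_, hop, hpos,
    h1.trans_lt (ENat.natCast_lt_top _), (h2.trans h3).trans le_self_add⟩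
  rw [← re_inner_reOp]
  exact hpos.re_inner_nonneg_right h
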